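/- Let $\mathbb{R}^{m,1}$ be $\mathbb{R}^{m+1}$ with the Lorentzian metric $\langle x,y\rangle=\sum_{i=1}^m x_iy_i-x_{m+1}y_{m+1}$, and let $\mathbb{H}^m(-1)=\{x\in\mathbb{R}^{m,1}\mid \langle x,x\rangle=-1,\ x_{m+1}>0\}$ be the hyperbolic space of curvature $-1$ with the induced Riemannian metric. Let $M$ be a smooth manifold (without boundary) of dimension $n$, not necessarily complete, smoothly immersed in $\mathbb{H}^m(-1)$, and suppose that $M$ is isoparametric, i.e. the curvature of its normal connection in $\mathbb{H}^m(-1)$ vanishes, and along every parallel normal vector field over a connected open subset of $M$ the principal curvatures (the eigenvalues of the shape operator, with multiplicity) are constant. If $M$ is minimal in $\mathbb{H}^m(-1)$, i.e. its mean curvature vector (the trace of the second fundamental form) is identically zero, then $M$ is totally geodesic in $\mathbb{H}^m(-1)$, i.e. its second fundamental form is identically zero. -/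

import Mathlib

open scoped Manifold ContDiff Topology

noncomputable section

namespace HypSubmanifold

/-- The underlying vector space of the Lorentz space `ℝ^{m,1}`. -/
abbrev LorentzSpace (m : ℕ) : Type := Fin (m + 1) → ℝ

/-- The Lorentzian metric `⟨x, y⟩ = x₁y₁ + ⋯ + x_m y_m - x_{m+1} y_{m+1}`. -/
def lorentz {m : ℕ} (x y : LorentzSpace m) : ℝ :=
  ∑ i : Fin m, x i.castSucc * y i.castSucc - x (Fin.last m) * y (Fin.last m)

/-- The hyperbolic space `ℍ^m(-1)`, as a sheet of the hyperboloid in `ℝ^{m,1}`. -/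
def hyperbolicSpace (m : ℕ) : Set (LorentzSpace m) :=
  {x | lorentz x x = -1 ∧ 0 < x (Fin.last m)}

/-- Orthogonal projection of `ℝ^{m,1}` onto the tangent space `x^⊥` of `ℍ^m(-1)` at `x`. -/
def hypProj {m : ℕ} (x X : LorentzSpace m) : LorentzSpace m :=
  X + lorentz X x • x

variable {n m : ℕ} {M : Type*} [TopologicalSpace M]
  [ChartedSpace (EuclideanSpace ℝ (Fin n)) M]

/-- The differential at `p` of a map from the `n`-manifold `M` to `ℝ^{m,1}`. -/
def diff (f : M → LorentzSpace m) (p : M) (v : TangentSpace (𝓡 n) p) : LorentzSpace m :=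
  mfderiv (𝓡 n) 𝓘(ℝ, LorentzSpace m) f p v

/-- `f` is a smooth immersion of `M` into `ℍ^m(-1)`. -/
structure IsHyperbolicImmersion (f : M → LorentzSpace m) : Prop where
  smooth : ContMDiff (𝓡 n) 𝓘(ℝ, LorentzSpace m) ∞ f
  mem : ∀ p, f p ∈ hyperbolicSpace m
  injective_diff : ∀ p, Function.Injective (diff (n := n) f p)

/-- The `i`-th vector of the coordinate basis of `T_p M` given by the preferred chart at `p`
(the one through which `TangentSpace` is identified with `ℝⁿ`). -/
def coordVec (p : M) (i : Fin n) : TangentSpace (𝓡 n) p :=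
  (EuclideanSpace.single i (1 : ℝ) : EuclideanSpace ℝ (Fin n))

/-- The Gram matrix `g_{ij}` of the induced metric. -/
def gram (f : M → LorentzSpace m) (p : M) : Matrix (Fin n) (Fin n) ℝ :=
  Matrix.of fun i j => lorentz (diff f p (coordVec p i)) (diff f p (coordVec p j))

/-- Orthogonal projection of `ℝ^{m,1}` onto the tangent space `df(T_p M)`:
`X ↦ ∑ g^{kl} ⟨X, ∂_l f⟩ ∂_k f`. -/
def tangentProj (f : M → LorentzSpace m) (p : M) (X : LorentzSpace m) : LorentzSpace m :=
  ∑ k : Fin n, ∑ l : Fin n,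
    ((gram f p)⁻¹ k l * lorentz X (diff f p (coordVec p l))) • diff f p (coordVec p k)

/-- `ξ` is a normal vector at `p` of the immersion `f` into `ℍ^m(-1)`: it is tangent to
`ℍ^m(-1)` and orthogonal to `df(T_p M)`. -/
def IsNormalVec (n : ℕ) {m : ℕ} {M : Type*} [TopologicalSpace M]
    [ChartedSpace (EuclideanSpace ℝ (Fin n)) M]
    (f : M → LorentzSpace m) (p : M) (ξ : LorentzSpace m) : Prop :=
  lorentz ξ (f p) = 0 ∧ ∀ v : TangentSpace (𝓡 n) p, lorentz ξ (diff f p v) = 0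

/-- Orthogonal projection of `ℝ^{m,1}` onto the normal space at `p` of `f` in `ℍ^m(-1)`. -/
def normalProj (n : ℕ) {m : ℕ} {M : Type*} [TopologicalSpace M]
    [ChartedSpace (EuclideanSpace ℝ (Fin n)) M]
    (f : M → LorentzSpace m) (p : M) (X : LorentzSpace m) : LorentzSpace m :=
  hypProj (f p) X - tangentProj (n := n) f p (hypProj (f p) X)

/-- The second derivative of `f` at `p` in the preferred chart at `p`. -/
def secondDeriv (f : M → LorentzSpace m) (p : M) (v w : TangentSpace (𝓡 n) p) :
    LorentzSpace m :=
  fderiv ℝ (fderiv ℝ (f ∘ (extChartAt (𝓡 n) p).symm)) (extChartAt (𝓡 n) p p)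
    (v : EuclideanSpace ℝ (Fin n)) (w : EuclideanSpace ℝ (Fin n))

/-- The second fundamental form of `f` in `ℍ^m(-1)`: the normal component of the second
derivative. (Two charts give second derivatives that differ by a tangent vector, so the normal
component does not depend on the chart.) -/
def secondFF (f : M → LorentzSpace m) (p : M) (v w : TangentSpace (𝓡 n) p) :
    LorentzSpace m :=
  normalProj n f p (secondDeriv f p v w)

/-- The mean curvature vector of `f` in `ℍ^m(-1)`: the trace of the second fundamental form. -/
def meanCurvature (n : ℕ) {m : ℕ} {M : Type*} [TopologicalSpace M]
    [ChartedSpace (EuclideanSpace ℝ (Fin n)) M]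
    (f : M → LorentzSpace m) (p : M) : LorentzSpace m :=
  ∑ i : Fin n, ∑ j : Fin n,
    (gram f p)⁻¹ i j • secondFF f p (coordVec p i) (coordVec p j)

/-- The matrix, in the coordinate basis, of the shape operator `A_ξ` at `p`, determined by
`g(A_ξ v, w) = ⟨II(v, w), ξ⟩`. -/
def shapeOperator (n : ℕ) {m : ℕ} {M : Type*} [TopologicalSpace M]
    [ChartedSpace (EuclideanSpace ℝ (Fin n)) M]
    (f : M → LorentzSpace m) (p : M) (ξ : LorentzSpace m) : Matrix (Fin n) (Fin n) ℝ :=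
  (gram f p)⁻¹ *
    Matrix.of fun i j => lorentz (secondFF f p (coordVec p i) (coordVec p j)) ξ

/-- The principal curvatures at `p` in the normal direction `ξ`: the eigenvalues of `A_ξ`,
with multiplicity. -/
def principalCurvatures (n : ℕ) {m : ℕ} {M : Type*} [TopologicalSpace M]
    [ChartedSpace (EuclideanSpace ℝ (Fin n)) M]
    (f : M → LorentzSpace m) (p : M) (ξ : LorentzSpace m) : Multiset ℝ :=
  (shapeOperator n f p ξ).charpoly.roots

/-- `ξ` is a smooth normal vector field of `f` over `U`. -/
structure IsNormalField (n : ℕ) {m : ℕ} {M : Type*} [TopologicalSpace M]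
    [ChartedSpace (EuclideanSpace ℝ (Fin n)) M]
    (f : M → LorentzSpace m) (U : Set M) (ξ : M → LorentzSpace m) : Prop where
  smooth : ContMDiffOn (𝓡 n) 𝓘(ℝ, LorentzSpace m) ∞ ξ U
  normal : ∀ p ∈ U, IsNormalVec n f p (ξ p)

/-- The normal connection `∇^⊥_v ξ` at `p`: the normal component of the derivative of `ξ`. -/
def normalDeriv (f ξ : M → LorentzSpace m) (p : M) (v : TangentSpace (𝓡 n) p) :
    LorentzSpace m :=
  normalProj n f p (diff ξ p v)

/-- `ξ` is a normal vector field over `U` that is parallel for the normal connection. -/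
structure IsParallelNormalField (n : ℕ) {m : ℕ} {M : Type*} [TopologicalSpace M]
    [ChartedSpace (EuclideanSpace ℝ (Fin n)) M]
    (f : M → LorentzSpace m) (U : Set M) (ξ : M → LorentzSpace m) : Prop
    extends IsNormalField n f U ξ where
  parallel : ∀ p ∈ U, ∀ v : TangentSpace (𝓡 n) p, normalDeriv f ξ p v = 0

/-- The curvature `R^⊥(V, W)ξ = ∇^⊥_V ∇^⊥_W ξ - ∇^⊥_W ∇^⊥_V ξ - ∇^⊥_{[V, W]} ξ` of the normal
connection. -/
def normalCurvature (f : M → LorentzSpace m) (V W : Π p : M, TangentSpace (𝓡 n) p)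
    (ξ : M → LorentzSpace m) (p : M) : LorentzSpace m :=
  normalDeriv f (fun q => normalDeriv f ξ q (W q)) p (V p)
    - normalDeriv f (fun q => normalDeriv f ξ q (V q)) p (W p)
    - normalDeriv f ξ p (VectorField.mlieBracket (𝓡 n) V W p)

/-- The vector field `V` is smooth on `U`. -/
def IsSmoothVectorField [IsManifold (𝓡 n) ∞ M]
    (V : Π p : M, TangentSpace (𝓡 n) p) (U : Set M) : Prop :=
  ContMDiffOn (𝓡 n) (𝓡 n).tangent ∞ (fun p => (⟨p, V p⟩ : TangentBundle (𝓡 n) M)) U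

/-- The normal bundle of `f` in `ℍ^m(-1)` is flat: its curvature vanishes. -/
def HasFlatNormalBundle (n : ℕ) {m : ℕ} {M : Type*} [TopologicalSpace M]
    [ChartedSpace (EuclideanSpace ℝ (Fin n)) M] [IsManifold (𝓡 n) ∞ M]
    (f : M → LorentzSpace m) : Prop :=
  ∀ U : Set M, IsOpen U → ∀ V W : (Π p : M, TangentSpace (𝓡 n) p),
    IsSmoothVectorField V U → IsSmoothVectorField W U →
    ∀ ξ : M → LorentzSpace m, IsNormalField n f U ξ →
    ∀ p ∈ U, normalCurvature f V W ξ p = 0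

/-- `f` is isoparametric in `ℍ^m(-1)`: its normal bundle is flat, and the principal curvatures
along any parallel normal vector field over a connected open subset of `M` are constant. -/
structure IsIsoparametric (n : ℕ) {m : ℕ} {M : Type*} [TopologicalSpace M]
    [ChartedSpace (EuclideanSpace ℝ (Fin n)) M] [IsManifold (𝓡 n) ∞ M]
    (f : M → LorentzSpace m) : Prop where
  flat : HasFlatNormalBundle n f
  constant : ∀ U : Set M, IsOpen U → IsPreconnected U →
    ∀ ξ : M → LorentzSpace m, IsParallelNormalField n f U ξ →
    ∀ p ∈ U, ∀ q ∈ U, principalCurvatures n f p (ξ p) = principalCurvatures n f q (ξ q)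

/-- `f` is minimal in `ℍ^m(-1)`: its mean curvature vector vanishes. -/
def IsMinimal (n : ℕ) {m : ℕ} {M : Type*} [TopologicalSpace M]
    [ChartedSpace (EuclideanSpace ℝ (Fin n)) M] (f : M → LorentzSpace m) : Prop :=
  ∀ p, meanCurvature n f p = 0

/-- `f` is totally geodesic in `ℍ^m(-1)`: its second fundamental form vanishes. -/
def IsTotallyGeodesic (n : ℕ) {m : ℕ} {M : Type*} [TopologicalSpace M]
    [ChartedSpace (EuclideanSpace ℝ (Fin n)) M] (f : M → LorentzSpace m) : Prop :=
  ∀ (p : M) (v w : TangentSpace (𝓡 n) p), secondFF f p v w = 0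

end HypSubmanifold

end

/-! Fix a parallel normal field `ξ`. Its shape operator has constant eigenvalues `l i`; take an
orthonormal eigenbasis `e i` at a point `p`. Let `N i` be the component of `∂²f(e i, e i)`
orthogonal to the tangent space in the flat space `ℝ^{m,1}`, so that `N i = II i + p`, where `II i`
is the second fundamental form in `ℍ^m(-1)`, and `⟨N i, N j⟩ = ⟨II i, II j⟩ - 1`. When `l i ≠ l j`
the mixed term `II(e i, e j)` vanishes, and by the Gauss equation `⟨N i, N j⟩ is the sectional
curvature of the plane of `e i` and `e j`.

The heart is a Cartan-type identity, `sum_normal_products_eq_zero`: the sum of `⟨N i, N j⟩` over all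
ordered pairs with `l i ≠ l j` is zero. Codazzi makes the derivative `T` of the shape operator
totally symmetric, constancy of the eigenvalues makes `T a b c` vanish when two of its indices share
an eigenvalue, and differentiating once more gives `⟨N a, N b⟩ = 2 ∑ c, T a b c ^ 2 / ((l b - l c) *
(l a - l c))`. These fractions cancel cyclically when summed over all triples.

Minimality says `∑ i, II i = 0`, so all the products `⟨II i, II j⟩` add up to zero. Those inside one
eigenspace add up to the square of a spacelike vector, which is nonnegative, so those with distinct
eigenvalues add up to at most zero. By the identity the latter sum is also the number of such pairs.
Hence there are none: the shape operator is a multiple of the identity with trace zero, so it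
vanishes (`shape_eq_zero`).

Flatness of the normal bundle extends any normal vector to a local parallel field
(`exists_parallel_section`). Extending `II(v, w)` itself shows that it is orthogonal to itself, and
it is spacelike, so it is zero. The rest translates between the manifold and a single chart. -/

namespace HypSubmanifold

/-! ### Lorentzian linear algebra. -/

section Lorentz

variable {m : ℕ}

theorem lorentz_comm (x y : LorentzSpace m) : lorentz x y = lorentz y x := by
  simp only [lorentz, mul_comm]

theorem lorentz_add_left (x y z : LorentzSpace m) :
    lorentz (x + y) z = lorentz x z + lorentz y z := by
  simp only [lorentz, Pi.add_apply, add_mul, Finset.sum_add_distrib]; ring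

theorem lorentz_smul_left (c : ℝ) (x y : LorentzSpace m) :
    lorentz (c • x) y = c * lorentz x y := by
  simp only [lorentz, Pi.smul_apply, smul_eq_mul, mul_sub, Finset.mul_sum, mul_assoc]

/-- The Lorentzian metric as a continuous bilinear map. -/
noncomputable def lorentzL (m : ℕ) : LorentzSpace m →L[ℝ] LorentzSpace m →L[ℝ] ℝ :=
  LinearMap.toContinuousLinearMap
    ((LinearMap.toContinuousLinearMap (𝕜 := ℝ) (E := LorentzSpace m) (F' := ℝ)).toLinearMap ∘ₗ
      LinearMap.mk₂ ℝ lorentz lorentz_add_left lorentz_smul_left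
        (fun x y z => by
          rw [lorentz_comm, lorentz_add_left, lorentz_comm y, lorentz_comm z])
        (fun c x y => by rw [lorentz_comm, lorentz_smul_left, lorentz_comm y, smul_eq_mul]))

/-- Vectors orthogonal to a point of the hyperboloid are spacelike. -/
theorem lorentz_self_nonneg_of_orthogonal {x y : LorentzSpace m} (hx : x ∈ hyperbolicSpace m)
    (hy : lorentz y x = 0) : 0 ≤ lorentz y y ∧ (lorentz y y = 0 → y = 0) := by
  obtain ⟨hxx, hpos⟩ := hx
  have hcs := Finset.sum_mul_sq_le_sq_mul_sq Finset.univ (fun i : Fin m => y i.castSucc)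
    (fun i => x i.castSucc)
  simp only [lorentz] at hxx hy ⊢
  set a := y (Fin.last m)
  set b := x (Fin.last m)
  have e1 : ∑ i : Fin m, y i.castSucc * x i.castSucc = a * b := by linarith
  have e2 : ∑ i : Fin m, x i.castSucc ^ 2 = b ^ 2 - 1 := by
    simp only [pow_two]; linarith
  have e3 : ∑ i : Fin m, y i.castSucc * y i.castSucc = ∑ i : Fin m, y i.castSucc ^ 2 := by
    simp only [pow_two]
  rw [e1, e2] at hcs
  rw [e3]
  set s := ∑ i : Fin m, y i.castSucc ^ 2 with hs
  have hs0 : 0 ≤ s := Finset.sum_nonneg fun i _ => sq_nonneg _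
  -- Cauchy–Schwarz on the space coordinates reads `(a * b)² ≤ s * (b² - 1)`; this is the same
  -- inequality rearranged.
  have key : s ≤ (s - a * a) * b ^ 2 := by nlinarith
  have hb : 0 < b ^ 2 := by positivity
  refine ⟨?_, fun h0 => ?_⟩
  · by_contra h
    push Not at h
    nlinarith
  · rw [h0, zero_mul] at key
    have hs1 : s = 0 := le_antisymm key hs0
    have ha : a = 0 := by
      have : a * a = 0 := by linarith
      simpa using this
    have hz := (Finset.sum_eq_zero_iff_of_nonneg fun i _ => sq_nonneg (y (Fin.castSucc i))).1
      (hs ▸ hs1)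
    funext i
    refine Fin.lastCases ha (fun j => ?_) i
    simpa using hz j (Finset.mem_univ j)

end Lorentz

/-! ### Differentiating identities that hold on an open set. -/

section Calculus

variable {V E G : Type*} [NormedAddCommGroup V] [NormedSpace ℝ V] [NormedAddCommGroup E]
  [NormedSpace ℝ E] [NormedAddCommGroup G] [NormedSpace ℝ G] {Ω : Set V} {x : V}

theorem hasFDerivAt_of_contDiffOn {g : V → G} (hg : ContDiffOn ℝ ∞ g Ω) (hΩ : IsOpen Ω)
    (hx : x ∈ Ω) : HasFDerivAt g (fderiv ℝ g x) x :=
  ((hg.differentiableOn (by simp)).differentiableAt (hΩ.mem_nhds hx)).hasFDerivAt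

theorem contDiffOn_fderiv {g : V → G} (hg : ContDiffOn ℝ ∞ g Ω) (hΩ : IsOpen Ω) :
    ContDiffOn ℝ ∞ (fderiv ℝ g) Ω :=
  hg.fderiv_of_isOpen hΩ (by simp)

theorem fderiv_fderiv_comm {g : V → G} (hg : ContDiffOn ℝ ∞ g Ω) (hΩ : IsOpen Ω)
    (hx : x ∈ Ω) (a b : V) :
    fderiv ℝ (fderiv ℝ g) x a b = fderiv ℝ (fderiv ℝ g) x b a :=
  ((hg.contDiffAt (hΩ.mem_nhds hx)).isSymmSndFDerivAt
    (by rw [minSmoothness_of_isRCLikeNormedField]; exact WithTop.coe_le_coe.2 (le_top : (2 : ℕ∞) ≤ ⊤))) a b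

theorem hasFDerivAt_eq_zero_of_eqOn {g : V → G} {g' : V →L[ℝ] G} (hΩ : IsOpen Ω) (hx : x ∈ Ω)
    (hg : HasFDerivAt g g' x) (h0 : ∀ y ∈ Ω, g y = 0) : g' = 0 :=
  hg.unique ((hasFDerivAt_const (0 : G) x).congr_of_eventuallyEq
    (Filter.eventually_of_mem (hΩ.mem_nhds hx) h0))

end Calculus

/-! ### Codazzi equation and derivatives of a self-adjoint operator field. -/

section Codazzi

variable {V E : Type*} [NormedAddCommGroup V] [NormedSpace ℝ V] [NormedAddCommGroup E]
  [NormedSpace ℝ E] {Ω : Set V} {F ξ : V → E} {S : V → E →L[ℝ] E}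

/-- Codazzi equation for an ambient operator `S` with `S ∘ dF = -dξ`. -/
theorem codazzi_of_weingarten (hΩ : IsOpen Ω) (hF : ContDiffOn ℝ ∞ F Ω)
    (hξ : ContDiffOn ℝ ∞ ξ Ω) (hS : ContDiffOn ℝ ∞ S Ω)
    (hW : ∀ x ∈ Ω, ∀ v, S x (fderiv ℝ F x v) = -fderiv ℝ ξ x v) {x : V} (hx : x ∈ Ω) (a b : V) :
    fderiv ℝ S x a (fderiv ℝ F x b) = fderiv ℝ S x b (fderiv ℝ F x a) := by
  -- This is the derivative along `a` of the Weingarten relation `S(dF b) = -dξ b`. Only second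
  -- derivatives remain on the right, so it is symmetric in `a` and `b`.
  have key : ∀ a b : V, fderiv ℝ S x a (fderiv ℝ F x b) =
      -(S x (fderiv ℝ (fderiv ℝ F) x a b)) - fderiv ℝ (fderiv ℝ ξ) x a b := by
    intro a b
    have h := (((hasFDerivAt_of_contDiffOn hS hΩ hx).clm_apply
      ((hasFDerivAt_of_contDiffOn (contDiffOn_fderiv hF hΩ) hΩ hx).clm_apply
        (hasFDerivAt_const b x))).add
      ((hasFDerivAt_of_contDiffOn (contDiffOn_fderiv hξ hΩ) hΩ hx).clm_apply
        (hasFDerivAt_const b x)))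
    have h0 := DFunLike.congr_fun (hasFDerivAt_eq_zero_of_eqOn hΩ hx h
      (fun y hy => by simp [hW y hy b])) a
    simp at h0
    rw [← sub_eq_zero, ← h0]; abel
  rw [key a b, key b a, fderiv_fderiv_comm hF hΩ hx, fderiv_fderiv_comm hξ hΩ hx]

theorem codazzi_deriv (hΩ : IsOpen Ω) (hF : ContDiffOn ℝ ∞ F Ω) (hS : ContDiffOn ℝ ∞ S Ω)
    (hC : ∀ x ∈ Ω, ∀ a b, fderiv ℝ S x a (fderiv ℝ F x b) = fderiv ℝ S x b (fderiv ℝ F x a))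
    {x : V} (hx : x ∈ Ω) (u a b : V) :
    fderiv ℝ (fderiv ℝ S) x u a (fderiv ℝ F x b) + fderiv ℝ S x a (fderiv ℝ (fderiv ℝ F) x u b) =
    fderiv ℝ (fderiv ℝ S) x u b (fderiv ℝ F x a) +
      fderiv ℝ S x b (fderiv ℝ (fderiv ℝ F) x u a) := by
  have d : ∀ a b : V, _ := fun a b =>
    ((hasFDerivAt_of_contDiffOn (contDiffOn_fderiv hS hΩ) hΩ hx).clm_apply
      (hasFDerivAt_const a x)).clm_apply
      ((hasFDerivAt_of_contDiffOn (contDiffOn_fderiv hF hΩ) hΩ hx).clm_apply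
        (hasFDerivAt_const b x))
  have h0 := DFunLike.congr_fun (hasFDerivAt_eq_zero_of_eqOn hΩ hx ((d a b).sub (d b a))
    (fun y hy => by simp [hC y hy a b])) u
  simp at h0
  rw [← sub_eq_zero, ← h0]; abel

theorem fderiv_eigenfield (hΩ : IsOpen Ω) (hS : ContDiffOn ℝ ∞ S Ω) {W : V → E} {l : ℝ}
    (hWs : ContDiffOn ℝ ∞ W Ω) (hW : ∀ x ∈ Ω, S x (W x) = l • W x) {x : V} (hx : x ∈ Ω) (a : V) :
    fderiv ℝ S x a (W x) = l • fderiv ℝ W x a - S x (fderiv ℝ W x a) := by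
  have h := ((hasFDerivAt_of_contDiffOn hS hΩ hx).clm_apply
    (hasFDerivAt_of_contDiffOn hWs hΩ hx)).sub
      ((hasFDerivAt_of_contDiffOn hWs hΩ hx).const_smul l)
  have h0 := DFunLike.congr_fun (hasFDerivAt_eq_zero_of_eqOn hΩ hx h
    (fun y hy => by simp [hW y hy])) a
  simp at h0
  rw [← sub_eq_zero, ← h0]; abel

/-- Second-order perturbation theory with a constant eigenvalue. Paired with `W x` the right side
vanishes for self-adjoint `S`, which leaves the second derivative of `S` in terms of first
derivatives. -/
theorem fderiv_fderiv_eigenfield (hΩ : IsOpen Ω) (hS : ContDiffOn ℝ ∞ S Ω) {W : V → E} {l : ℝ}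
    (hWs : ContDiffOn ℝ ∞ W Ω) (hW : ∀ x ∈ Ω, S x (W x) = l • W x) {x : V} (hx : x ∈ Ω) (a : V) :
    fderiv ℝ (fderiv ℝ S) x a a (W x) + (2 : ℝ) • fderiv ℝ S x a (fderiv ℝ W x a) =
      l • fderiv ℝ (fderiv ℝ W) x a a - S x (fderiv ℝ (fderiv ℝ W) x a a) := by
  have hS1 := (hasFDerivAt_of_contDiffOn (contDiffOn_fderiv hS hΩ) hΩ hx).clm_apply
    (hasFDerivAt_const a x)
  have hW1 := (hasFDerivAt_of_contDiffOn (contDiffOn_fderiv hWs hΩ) hΩ hx).clm_apply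
    (hasFDerivAt_const a x)
  have h := (hS1.clm_apply (hasFDerivAt_of_contDiffOn hWs hΩ hx)).sub
    ((hW1.const_smul l).sub ((hasFDerivAt_of_contDiffOn hS hΩ hx).clm_apply hW1))
  have h0 := DFunLike.congr_fun (hasFDerivAt_eq_zero_of_eqOn hΩ hx h
    (fun y hy => by simp [fderiv_eigenfield hΩ hS hWs hW hy])) a
  simp at h0
  rw [← sub_eq_zero, ← h0, two_smul]; abel

variable {B : E →L[ℝ] E →L[ℝ] ℝ}

theorem fderiv_selfAdjoint (hΩ : IsOpen Ω) (hS : ContDiffOn ℝ ∞ S Ω)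
    (hsym : ∀ x ∈ Ω, ∀ y z, B (S x y) z = B y (S x z)) {x : V} (hx : x ∈ Ω) (a : V) (y z : E) :
    B (fderiv ℝ S x a y) z = B y (fderiv ℝ S x a z) := by
  have d : ∀ y : E, _ := fun y =>
    (hasFDerivAt_of_contDiffOn hS hΩ hx).clm_apply (hasFDerivAt_const y x)
  have h := (((B.flip z).hasFDerivAt.comp x (d y))).sub ((B y).hasFDerivAt.comp x (d z))
  have h0 := DFunLike.congr_fun (hasFDerivAt_eq_zero_of_eqOn hΩ hx h
    (fun w hw => by simp [hsym w hw])) a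
  simp at h0
  linarith

theorem fderiv_fderiv_selfAdjoint (hΩ : IsOpen Ω) (hS : ContDiffOn ℝ ∞ S Ω)
    (hsym : ∀ x ∈ Ω, ∀ y z, B (S x y) z = B y (S x z)) {x : V} (hx : x ∈ Ω) (a b : V) (y z : E) :
    B (fderiv ℝ (fderiv ℝ S) x a b y) z = B y (fderiv ℝ (fderiv ℝ S) x a b z) := by
  have d : ∀ y : E, _ := fun y =>
    ((hasFDerivAt_of_contDiffOn (contDiffOn_fderiv hS hΩ) hΩ hx).clm_apply
      (hasFDerivAt_const b x)).clm_apply (hasFDerivAt_const y x)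
  have h := (((B.flip z).hasFDerivAt.comp x (d y))).sub ((B y).hasFDerivAt.comp x (d z))
  have h0 := DFunLike.congr_fun (hasFDerivAt_eq_zero_of_eqOn hΩ hx h
    (fun w hw => by simp [fderiv_selfAdjoint hΩ hS hsym hw])) a
  simp at h0
  linarith

end Codazzi

/-! ### The Cartan-type identity. -/

/-- The cyclic cancellation of `T_{abc}² / ((λ_b - λ_c)(λ_a - λ_c))`. -/
theorem sum_sq_div_eq_zero {ι : Type*} [Fintype ι] (T : ι → ι → ι → ℝ) (l : ι → ℝ)
    (h12 : ∀ a b c, T a b c = T b a c) (h23 : ∀ a b c, T a b c = T a c b)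
    (h0 : ∀ a b c, l b = l c → T a b c = 0) :
    ∑ a, ∑ b, ∑ c, T a b c ^ 2 / ((l b - l c) * (l a - l c)) = 0 := by
  set g : ι → ι → ι → ℝ := fun a b c => T a b c ^ 2 / ((l b - l c) * (l a - l c)) with hg
  have r1 : ∑ a, ∑ b, ∑ c, g a b c = ∑ a, ∑ b, ∑ c, g b c a := by
    conv_rhs => rw [Finset.sum_comm]
    conv_rhs => enter [2, a]; rw [Finset.sum_comm]
  have r2 : ∑ a, ∑ b, ∑ c, g a b c = ∑ a, ∑ b, ∑ c, g c a b := by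
    rw [Finset.sum_comm]
    conv_lhs => enter [2, a]; rw [Finset.sum_comm]
  -- The triple sum is invariant under cyclic relabelling, so three times it is the sum of the
  -- cyclic sums. `T` takes the same value on the three rotations, and the three fractions add up to
  -- zero. If two of the eigenvalues coincide, `T` itself is zero.
  have hs : ∑ a, ∑ b, ∑ c, (g a b c + g b c a + g c a b) = 0 := by
    refine Finset.sum_eq_zero fun a _ => Finset.sum_eq_zero fun b _ =>
      Finset.sum_eq_zero fun c _ => ?_
    have e1 : T b c a = T a b c := by rw [h23, h12]
    have e2 : T c a b = T a b c := by rw [h12, h23]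
    simp only [hg, e1, e2]
    by_cases hbc : l b = l c
    · simp [h0 a b c hbc]
    by_cases hca : l c = l a
    · have : T a b c = 0 := by rw [← e1]; exact h0 _ _ _ hca
      simp [this]
    by_cases hab : l a = l b
    · have : T a b c = 0 := by rw [← e2]; exact h0 _ _ _ hab
      simp [this]
    have n1 := sub_ne_zero.2 hbc
    have n2 := sub_ne_zero.2 hca
    have n3 := sub_ne_zero.2 hab
    have m1 : l c - l b ≠ 0 := sub_ne_zero.2 (Ne.symm hbc)
    have m2 : l a - l c ≠ 0 := sub_ne_zero.2 (Ne.symm hca)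
    have m3 : l b - l a ≠ 0 := sub_ne_zero.2 (Ne.symm hab)
    rw [div_add_div _ _ (mul_ne_zero n1 m2) (mul_ne_zero n2 m3),
      div_add_div _ _ (mul_ne_zero (mul_ne_zero n1 m2) (mul_ne_zero n2 m3)) (mul_ne_zero n3 m1),
      div_eq_zero_iff]
    left; ring
  simp only [Finset.sum_add_distrib] at hs
  rw [← r1, ← r2] at hs
  linarith

section NormalPart

variable {E ι : Type*} [NormedAddCommGroup E] [NormedSpace ℝ E] [Fintype ι]

/-- The component of `y` orthogonal to the orthonormal family `w`. -/
noncomputable def orthPart (B : E →L[ℝ] E →L[ℝ] ℝ) (w : ι → E) (y : E) : E :=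
  y - ∑ c, B y (w c) • w c

variable {B : E →L[ℝ] E →L[ℝ] ℝ} {w : ι → E}

theorem orthPart_orthogonal [DecidableEq ι] (hw : ∀ i j, B (w i) (w j) = if i = j then 1 else 0)
    (y : E) (c : ι) : B (orthPart B w y) (w c) = 0 := by
  simp [orthPart, hw]

theorem apply_eq_orthPart_add_sum (hB : ∀ x y, B x y = B y x)
    (y z : E) :
    B y z = B (orthPart B w y) z + ∑ c, B y (w c) * B z (w c) := by
  simp [orthPart, fun c => hB (w c) z]

theorem apply_orthPart_right [DecidableEq ι]
    (hw : ∀ i j, B (w i) (w j) = if i = j then 1 else 0) (y z : E) :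
    B (orthPart B w y) (orthPart B w z) = B (orthPart B w y) z := by
  have h := orthPart_orthogonal hw y
  conv_lhs => enter [2]; rw [orthPart]
  simp [h]

end NormalPart

section CartanIdentity

variable {V E ι : Type*} [NormedAddCommGroup V] [NormedSpace ℝ V] [NormedAddCommGroup E]
  [NormedSpace ℝ E] [Fintype ι] [DecidableEq ι] {Ω : Set V} {F ξ : V → E} {S : V → E →L[ℝ] E}
  {B : E →L[ℝ] E →L[ℝ] ℝ}

/-- If the operator `S`, with `S ∘ dF = -dξ`, has constant eigenvalues, then the sum of the
products `⟨F_ii^⊥, F_jj^⊥⟩` over all pairs of eigendirections with distinct eigenvalues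
vanishes. -/
theorem sum_normal_products_eq_zero (hB : ∀ x y, B x y = B y x) (hΩ : IsOpen Ω)
    (hF : ContDiffOn ℝ ∞ F Ω) (hξ : ContDiffOn ℝ ∞ ξ Ω) (hS : ContDiffOn ℝ ∞ S Ω)
    (hW : ∀ x ∈ Ω, ∀ v, S x (fderiv ℝ F x v) = -fderiv ℝ ξ x v)
    (hsym : ∀ x ∈ Ω, ∀ y z, B (S x y) z = B y (S x z)) {x : V} (hx : x ∈ Ω)
    (e : Module.Basis ι ℝ V) (l : ι → ℝ) (β : ι → V → V) (hβ : ∀ i, ContDiffOn ℝ ∞ (β i) Ω)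
    (hβx : ∀ i, β i x = e i)
    (heig : ∀ i, ∀ y ∈ Ω, S y (fderiv ℝ F y (β i y)) = l i • fderiv ℝ F y (β i y))
    (horth : ∀ i j, B (fderiv ℝ F x (e i)) (fderiv ℝ F x (e j)) = if i = j then 1 else 0)
    (hker : ∀ η, (∀ i, B η (fderiv ℝ F x (e i)) = 0) → S x η = 0) :
    ∑ i, ∑ j, (if l i = l j then 0 else
      B (orthPart B (fun c => fderiv ℝ F x (e c)) (fderiv ℝ (fderiv ℝ F) x (e i) (e i)))
        (orthPart B (fun c => fderiv ℝ F x (e c)) (fderiv ℝ (fderiv ℝ F) x (e j) (e j)))) = 0 := by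
  set J := fderiv ℝ F x with hJ
  set H := fderiv ℝ (fderiv ℝ F) x with hH
  set w : ι → E := fun c => J (e c) with hw
  set N := orthPart B w with hN
  set D := fderiv ℝ S x with hD
  set W : ι → V → E := fun i y => fderiv ℝ F y (β i y) with hWdef
  have hWs : ∀ i, ContDiffOn ℝ ∞ (W i) Ω := fun i => (contDiffOn_fderiv hF hΩ).clm_apply (hβ i)
  have hWx : ∀ i, W i x = w i := fun i => by simp [hWdef, hβx, hw, hJ]
  have hC := fun y (hy : y ∈ Ω) a b => codazzi_of_weingarten hΩ hF hξ hS hW hy a b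
  have hDsym := fun a y z => fderiv_selfAdjoint hΩ hS hsym hx a y z
  have hSw : ∀ i, S x (w i) = l i • w i := fun i => by
    have := heig i x hx; rwa [hβx] at this
  have horthJ : ∀ η, (∀ i, B η (w i) = 0) → ∀ v, B η (J v) = 0 := by
    intro η h v
    rw [← e.sum_repr v]
    simp only [map_sum, map_smul, smul_eq_mul]
    exact Finset.sum_eq_zero fun i _ => by rw [h i, mul_zero]
  have hWa : ∀ i a, fderiv ℝ (W i) x a = H a (e i) + J (fderiv ℝ (β i) x a) := by
    intro i a
    have h := (hasFDerivAt_of_contDiffOn (contDiffOn_fderiv hF hΩ) hΩ hx).clm_apply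
      (hasFDerivAt_of_contDiffOn (hβ i) hΩ hx)
    rw [h.fderiv]
    simp [hβx, hH, hJ, add_comm]
  have h1 : ∀ i a z, B (D a (w i)) z
      = l i * B (fderiv ℝ (W i) x a) z - B (fderiv ℝ (W i) x a) (S x z) := by
    intro i a z
    have h := fderiv_eigenfield hΩ hS (hWs i) (heig i) hx a
    rw [hWx] at h
    rw [h]
    simp [hsym x hx]
  -- `S` is self-adjoint and kills normal vectors, so only the term with the eigenvalue survives.
  have hnor : ∀ i a η, (∀ c, B η (w c) = 0) → B (D a (w i)) η = l i * B (H a (e i)) η := by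
    intro i a η hη
    rw [h1, hker η hη, hWa, map_add, add_apply, hB (J _) η, horthJ η hη]
    simp
  -- `T` is symmetric in its first two indices by Codazzi and in its last two by self-adjointness,
  -- hence totally symmetric.
  set T : ι → ι → ι → ℝ := fun a b c => B (D (e a) (w b)) (w c) with hT
  have hTτ : ∀ a b c, T a b c = (l b - l c) * B (fderiv ℝ (W b) x (e a)) (w c) := by
    intro a b c
    simp only [hT]
    rw [h1, hSw, map_smul, smul_eq_mul, sub_mul]
  have hT12 : ∀ a b c, T a b c = T b a c := fun a b c => by
    simp only [hT, hw, hD, hJ]; rw [hC x hx]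
  have hT23 : ∀ a b c, T a b c = T a c b := fun a b c => by
    simp only [hT]; rw [hDsym, hB]
  have hT0 : ∀ a b c, l b = l c → T a b c = 0 := fun a b c h => by rw [hTτ, h]; ring
  have hNo := fun y c => orthPart_orthogonal (B := B) (w := w) horth y c
  -- By `hnor` the two sides of Codazzi have normal parts `l b` and `l a` times that of `H (e a) (e
  -- b)`.
  have hoff : ∀ a b, l a ≠ l b → ∀ η, (∀ c, B η (w c) = 0) → B (H (e a) (e b)) η = 0 := by
    intro a b hab η hη
    have e1 := hnor b (e a) η hη
    have e2 := hnor a (e b) η hη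
    rw [show D (e a) (w b) = D (e b) (w a) from hC x hx _ _, e2,
      show H (e b) (e a) = H (e a) (e b) from fderiv_fderiv_comm hF hΩ hx _ _] at e1
    have : (l a - l b) * B (H (e a) (e b)) η = 0 := by rw [sub_mul, e1, sub_self]
    exact (mul_eq_zero.1 this).resolve_left (sub_ne_zero.2 hab)
  have hpert : ∀ a b, l a ≠ l b → B (fderiv ℝ (fderiv ℝ S) x (e a) (e a) (w b)) (w b) =
      -2 * ∑ c, T a b c ^ 2 / (l b - l c) := by
    intro a b hab
    have h2 := fderiv_fderiv_eigenfield hΩ hS (hWs b) (heig b) hx (e a)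
    have h3 := congrArg (fun y => B y (w b)) h2
    simp only [map_add, map_sub, map_smul, add_apply,
      sub_apply, smul_apply, smul_eq_mul] at h3
    rw [hsym x hx, hSw, map_smul, smul_eq_mul, sub_self, hWx, hDsym] at h3
    -- Expand in the frame `w`: the normal part drops out by `hoff`, and `hTτ` turns each tangential
    -- product into a square over an eigenvalue gap. Where the gap is zero, both `T` and the
    -- quotient are zero.
    have h4 : B (fderiv ℝ (W b) x (e a)) (D (e a) (w b)) = ∑ c, T a b c ^ 2 / (l b - l c) := by
      rw [apply_eq_orthPart_add_sum hB (w := w), hB (orthPart B w _), hnor b (e a) _ (hNo _),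
        hoff a b hab _ (hNo _), mul_zero, zero_add]
      refine Finset.sum_congr rfl fun c _ => ?_
      change _ * T a b c = _
      by_cases hbc : l b = l c
      · simp [hT0 a b c hbc]
      · have n := sub_ne_zero.2 hbc
        rw [eq_div_iff n, pow_two]
        nth_rewrite 2 [hTτ]
        ring
    rw [← h4]
    linarith
  -- Since `T b b c = 0` for every `c`, the vector `D (e b) (w b)` has no tangential part, and its
  -- normal part comes from `hnor`.
  have hmix : ∀ a b, B (H (e a) (e a)) (D (e b) (w b)) =
      l b * B (N (H (e a) (e a))) (N (H (e b) (e b))) := by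
    intro a b
    rw [apply_eq_orthPart_add_sum hB (w := w), hB (orthPart B w _), hnor b (e b) _ (hNo _),
      apply_orthPart_right horth, hB (orthPart B w _)]
    rw [Finset.sum_eq_zero, add_zero]
    intro c _
    have : B (D (e b) (w b)) (w c) = 0 := by
      change T b b c = 0
      rw [hT23, hT12]; exact hT0 c b b rfl
    rw [this, mul_zero]
  -- Differentiate Codazzi for `(a, b)` and for `(b, a)` and subtract. The mixed second derivatives
  -- of `S` cancel by self-adjointness, the terms with `H (e a) (e b)` by symmetry; what remains is
  -- `(l b - l a)` times the product sought, against the two perturbation sums.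
  have hK : ∀ a b, l a ≠ l b → B (N (H (e a) (e a))) (N (H (e b) (e b))) =
      2 * ∑ c, T a b c ^ 2 / ((l b - l c) * (l a - l c)) := by
    intro a b hab
    have c1 := congrArg (fun y => B y (w b)) (codazzi_deriv hΩ hF hS hC hx (e a) (e a) (e b))
    have c2 := congrArg (fun y => B y (w a)) (codazzi_deriv hΩ hF hS hC hx (e b) (e b) (e a))
    simp only [map_add, add_apply] at c1 c2
    have s1 := fderiv_fderiv_selfAdjoint hΩ hS hsym hx (e a) (e b) (w a) (w b)
    rw [fderiv_fderiv_comm hS hΩ hx (e b) (e a)] at c2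
    rw [hDsym, hDsym] at c1 c2
    have p1 := hpert a b hab
    have p2 := hpert b a (Ne.symm hab)
    have m1 := hmix a b
    have m2 := hmix b a
    have t1 : D (e a) (w b) = D (e b) (w a) := hC x hx _ _
    have t2 : H (e a) (e b) = H (e b) (e a) := fderiv_fderiv_comm hF hΩ hx _ _
    rw [hB _ (fderiv ℝ (fderiv ℝ S) x (e a) (e b) (w b))] at s1
    change B (fderiv ℝ (fderiv ℝ S) x (e a) (e a) (w b)) (w b) + B (H (e a) (e b)) (D (e a) (w b))
      = B (fderiv ℝ (fderiv ℝ S) x (e a) (e b) (w a)) (w b) +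
        B (H (e a) (e a)) (D (e b) (w b)) at c1
    change B (fderiv ℝ (fderiv ℝ S) x (e b) (e b) (w a)) (w a) + B (H (e b) (e a)) (D (e b) (w a))
      = B (fderiv ℝ (fderiv ℝ S) x (e a) (e b) (w b)) (w a) +
        B (H (e b) (e b)) (D (e a) (w a)) at c2
    rw [t1, t2, p1, m1] at c1
    rw [p2, m2, hB (N (H (e b) (e b)))] at c2
    have n := sub_ne_zero.2 (Ne.symm hab)
    have hsum : -2 * ∑ c, T a b c ^ 2 / (l b - l c) + 2 * ∑ c, T b a c ^ 2 / (l a - l c) =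
        (l b - l a) * (2 * ∑ c, T a b c ^ 2 / ((l b - l c) * (l a - l c))) := by
      simp only [Finset.mul_sum]
      rw [← Finset.sum_add_distrib]
      refine Finset.sum_congr rfl fun c _ => ?_
      rw [hT12 b a c]
      by_cases hbc : l b = l c
      · simp [hT0 a b c hbc]
      by_cases hac : l a = l c
      · have : T a b c = 0 := by rw [hT12]; exact hT0 _ _ _ hac
        simp [this]
      have n1 := sub_ne_zero.2 hbc
      have n2 := sub_ne_zero.2 hac
      field_simp
      ring
    refine mul_left_cancel₀ n ?_
    rw [← hsum]
    linarith
  calc _ = ∑ a, ∑ b, 2 * ∑ c, T a b c ^ 2 / ((l b - l c) * (l a - l c)) := by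
        refine Finset.sum_congr rfl fun a _ => Finset.sum_congr rfl fun b _ => ?_
        split_ifs with h
        -- The formula extends to pairs with equal eigenvalues, where it gives zero. The sum may
        -- therefore run over all triples, as the cyclic cancellation needs.
        · have : ∀ c, T a b c = 0 := fun c => by
            rw [hT23, hT12]; exact hT0 _ _ _ h
          simp [this]
        · exact hK a b h
    _ = 2 * ∑ a, ∑ b, ∑ c, T a b c ^ 2 / ((l b - l c) * (l a - l c)) := by
        simp only [Finset.mul_sum]
    _ = 0 := by rw [sum_sq_div_eq_zero T l hT12 hT23 hT0, mul_zero]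

end CartanIdentity

/-! ### Parallel sections of a flat family of projections. -/

section Transport

open Metric Set

set_option maxSynthPendingDepth 4

variable {V E G : Type*} [NormedAddCommGroup V] [NormedSpace ℝ V] [NormedAddCommGroup E]
  [NormedSpace ℝ E] [NormedAddCommGroup G] [NormedSpace ℝ G] {Ω s : Set V}

theorem norm_sub_sub_fderiv_le {g : V → G} (hg : ContDiffOn ℝ ∞ g Ω) (hΩ : IsOpen Ω)
    (hs : Convex ℝ s) (hsΩ : s ⊆ Ω) {C : ℝ} (hC0 : 0 ≤ C)
    (hC : ∀ x ∈ s, ‖fderiv ℝ (fderiv ℝ g) x‖ ≤ C) {p q : V} (hp : p ∈ s) (hq : q ∈ s) :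
    ‖g q - g p - fderiv ℝ g p (q - p)‖ ≤ C * ‖q - p‖ ^ 2 := by
  -- Restricting to this convex set turns the bound on the second derivative into a uniform bound `C
  -- * ‖q - p‖` on the variation of the first; a second use of the mean value inequality gives the
  -- square.
  have h1 : ∀ x ∈ s ∩ closedBall p ‖q - p‖, ‖fderiv ℝ g x - fderiv ℝ g p‖ ≤ C * ‖q - p‖ := by
    intro x hx
    refine (hs.norm_image_sub_le_of_norm_hasFDerivWithin_le (fun y hy =>
      (hasFDerivAt_of_contDiffOn (contDiffOn_fderiv hg hΩ) hΩ (hsΩ hy)).hasFDerivWithinAt)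
      hC hp hx.1).trans ?_
    exact mul_le_mul_of_nonneg_left (by simpa [dist_eq_norm] using hx.2) hC0
  have h2 := (hs.inter (convex_closedBall p ‖q - p‖)).norm_image_sub_le_of_norm_hasFDerivWithin_le'
    (fun y hy => (hasFDerivAt_of_contDiffOn hg hΩ (hsΩ hy.1)).hasFDerivWithinAt) h1
    ⟨hp, by simp⟩ ⟨hq, by simp [dist_eq_norm]⟩
  rw [pow_two, ← mul_assoc]
  exact h2

variable {N : V → E →L[ℝ] E}

/-- The derivative of a family of projections. -/
theorem projection_comp_fderiv (hΩ : IsOpen Ω) (hN : ContDiffOn ℝ ∞ N Ω)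
    (hNN : ∀ x ∈ Ω, ∀ y, N x (N x y) = N x y) {x : V} (hx : x ∈ Ω) (v : V) (y : E) :
    N x (fderiv ℝ N x v y) = fderiv ℝ N x v y - fderiv ℝ N x v (N x y) := by
  have d := (hasFDerivAt_of_contDiffOn hN hΩ hx)
  have d1 := d.clm_apply (hasFDerivAt_const y x)
  have h0 := DFunLike.congr_fun (hasFDerivAt_eq_zero_of_eqOn hΩ hx ((d.clm_apply d1).sub d1)
    (fun z hz => by simp [hNN z hz])) v
  simp at h0
  rw [← sub_eq_zero, ← h0]; abel

/-- Differentiating `N ∘ N = N` shows that `dN` maps the image of `N` into its kernel and the kernel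
into the image. For `y` in the image, both double derivatives therefore already lie in the image,
and the outer `N` in `hflat` can be dropped. -/
theorem fderiv_projection_comm (hΩ : IsOpen Ω) (hN : ContDiffOn ℝ ∞ N Ω)
    (hNN : ∀ x ∈ Ω, ∀ y, N x (N x y) = N x y)
    (hflat : ∀ x ∈ Ω, ∀ v w y,
      N x (fderiv ℝ N x v (fderiv ℝ N x w y)) = N x (fderiv ℝ N x w (fderiv ℝ N x v y)))
    {x : V} (hx : x ∈ Ω) (v w : V) {y : E} (hy : N x y = y) :
    fderiv ℝ N x v (fderiv ℝ N x w y) = fderiv ℝ N x w (fderiv ℝ N x v y) := by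
  have key : ∀ v w, N x (fderiv ℝ N x v (fderiv ℝ N x w y)) =
      fderiv ℝ N x v (fderiv ℝ N x w y) := by
    intro v w
    rw [projection_comp_fderiv hΩ hN hNN hx v, projection_comp_fderiv hΩ hN hNN hx w, hy]
    simp
  rw [← key v w, ← key w v, hflat x hx]

/-- A solution over `[0, 1]` of the transport equation `u' = (dN)(y) u` along the ray
`t ↦ x₀ + t y`. -/
def IsRayTransport (N : V → E →L[ℝ] E) (x₀ y : V) (η : E) (u : ℝ → E) : Prop :=
  u 0 = η ∧ ∀ t ∈ Icc (0 : ℝ) 1,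
    HasDerivWithinAt u (fderiv ℝ N (x₀ + t • y) y (u t)) (Icc 0 1) t

theorem add_smul_mem_ball {x₀ y : V} {r : ℝ} (hy : y ∈ ball (0 : V) r) {t : ℝ}
    (ht : t ∈ Icc (0 : ℝ) 1) : x₀ + t • y ∈ ball x₀ r := by
  simp only [mem_ball, dist_zero_right, dist_self_add_left] at hy ⊢
  rw [norm_smul, Real.norm_of_nonneg ht.1]
  exact (mul_le_of_le_one_left (norm_nonneg _) ht.2).trans_lt hy

theorem continuous_ray (x₀ y : V) : Continuous fun t : ℝ => x₀ + t • y := by fun_prop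

theorem hasDerivAt_ray (x₀ y : V) (t : ℝ) : HasDerivAt (fun t : ℝ => x₀ + t • y) y t := by
  simpa using ((hasDerivAt_id t).smul_const y).const_add x₀

/-- Picard–Lindelöf on the ball of radius 1 about `η`: the condition `hCr` bounds the speed there by
1, so the solution lasts for the whole unit interval. -/
theorem exists_isRayTransport [CompleteSpace E] (hΩ : IsOpen Ω) (hN : ContDiffOn ℝ ∞ N Ω)
    {x₀ : V} {r C : ℝ} (hr : 0 < r) (hball : ball x₀ r ⊆ Ω)
    (hC1 : ∀ x ∈ ball x₀ r, ‖fderiv ℝ N x‖ ≤ C) (η : E) (hCr : C * r * (‖η‖ + 1) ≤ 1)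
    {y : V} (hy : y ∈ ball (0 : V) r) : ∃ u, IsRayTransport N x₀ y η u := by
  have hC0 : 0 ≤ C := (norm_nonneg _).trans (hC1 x₀ (mem_ball_self hr))
  have hbd : ∀ t ∈ Icc (0 : ℝ) 1, ‖fderiv ℝ N (x₀ + t • y) y‖ ≤ C * r := by
    intro t ht
    refine (ContinuousLinearMap.le_opNorm _ _).trans ?_
    exact mul_le_mul (hC1 _ (add_smul_mem_ball hy ht)) (mem_ball_zero_iff.1 hy).le (norm_nonneg _) hC0
  have hCr1 : C * r ≤ 1 := by
    refine le_trans ?_ hCr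
    exact le_mul_of_one_le_right (by positivity) (by linarith [norm_nonneg η])
  have hPL : IsPicardLindelof (fun t (z : E) => fderiv ℝ N (x₀ + t • y) y z)
      (⟨0, by simp⟩ : Icc (0 : ℝ) 1) η 1 0 1 1 := by
    refine ⟨fun t ht => ?_, fun z _ => ?_, fun t ht z hz => ?_, by simp⟩
    · refine ((fderiv ℝ N (x₀ + t • y) y).lipschitz.weaken ?_).lipschitzOnWith
      exact_mod_cast (hbd t ht).trans hCr1
    · have : ContinuousOn (fun t : ℝ => fderiv ℝ N (x₀ + t • y)) (Icc 0 1) :=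
        (contDiffOn_fderiv hN hΩ).continuousOn.comp (continuous_ray x₀ y).continuousOn
          (fun t ht => hball (add_smul_mem_ball hy ht))
      exact (this.clm_apply continuousOn_const).clm_apply continuousOn_const
    · have hz' : ‖z‖ ≤ ‖η‖ + 1 := by
        have : ‖z - η‖ ≤ 1 := by simpa [dist_eq_norm] using hz
        have := norm_le_norm_add_norm_sub' z η
        linarith
      refine (ContinuousLinearMap.le_opNorm _ _).trans ?_
      refine le_trans ?_ hCr
      exact mul_le_mul (hbd t ht) hz' (norm_nonneg _) (by positivity)
  obtain ⟨u, hu0, hu⟩ := hPL.exists_eq_forall_mem_Icc_hasDerivWithinAt₀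
  exact ⟨u, hu0, hu⟩

theorem hasDerivWithinAt_Ici_of_Icc {u : ℝ → E} {u' : E} {t : ℝ} (ht : t ∈ Ico (0 : ℝ) 1)
    (h : HasDerivWithinAt u u' (Icc 0 1) t) : HasDerivWithinAt u u' (Ici t) t :=
  h.mono_of_mem_nhdsWithin (Icc_mem_nhdsGE_of_mem ht)

/-- The defect `u - N u` solves a homogeneous linear equation and starts at zero. -/
theorem IsRayTransport.normal (hΩ : IsOpen Ω) (hN : ContDiffOn ℝ ∞ N Ω)
    (hNN : ∀ x ∈ Ω, ∀ y, N x (N x y) = N x y) {x₀ y : V} {η : E} {u : ℝ → E}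
    (hu : IsRayTransport N x₀ y η u) (hη : N x₀ η = η) {K : ℝ}
    (hray : ∀ t ∈ Icc (0 : ℝ) 1, x₀ + t • y ∈ Ω)
    (hK : ∀ t ∈ Icc (0 : ℝ) 1, ‖fderiv ℝ N (x₀ + t • y) y‖ ≤ K) {t : ℝ}
    (ht : t ∈ Icc (0 : ℝ) 1) : N (x₀ + t • y) (u t) = u t := by
  obtain ⟨hu0, hu⟩ := hu
  have hd : ∀ t ∈ Icc (0 : ℝ) 1, HasDerivWithinAt (fun t => u t - N (x₀ + t • y) (u t))
      (-(fderiv ℝ N (x₀ + t • y) y (u t - N (x₀ + t • y) (u t)))) (Icc 0 1) t := by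
    intro t ht
    have h1 : HasDerivWithinAt (fun t : ℝ => N (x₀ + t • y)) (fderiv ℝ N (x₀ + t • y) y)
        (Icc 0 1) t :=
      ((hasFDerivAt_of_contDiffOn hN hΩ (hray t ht)).comp_hasDerivAt t
        (hasDerivAt_ray x₀ y t)).hasDerivWithinAt
    refine ((hu t ht).sub (h1.clm_apply (hu t ht))).congr_deriv ?_
    rw [projection_comp_fderiv hΩ hN hNN (hray t ht)]
    simp only [map_sub]; abel
  have := eq_zero_of_abs_deriv_le_mul_abs_self_of_eq_zero_right (K := K)
    (fun t ht => (hd t ht).continuousWithinAt)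
    (fun t ht => hasDerivWithinAt_Ici_of_Icc ht (hd t (Ico_subset_Icc_self ht)))
    (by simp [hu0, hη])
    (fun t ht => by
      rw [norm_neg]
      exact (ContinuousLinearMap.le_opNorm _ _).trans (mul_le_mul_of_nonneg_right
        (hK t (Ico_subset_Icc_self ht)) (norm_nonneg _))) t ht
  exact (sub_eq_zero.1 this).symm

/-- Comparison of the transports along two nearby rays. -/
theorem IsRayTransport.norm_sub_fderiv_le (hΩ : IsOpen Ω) (hN : ContDiffOn ℝ ∞ N Ω)
    (hNN : ∀ x ∈ Ω, ∀ y, N x (N x y) = N x y)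
    (hflat : ∀ x ∈ Ω, ∀ v w y,
      N x (fderiv ℝ N x v (fderiv ℝ N x w y)) = N x (fderiv ℝ N x w (fderiv ℝ N x v y)))
    {x₀ : V} {r C : ℝ} (hr2 : r ≤ 1 / 2) (hball : ball x₀ r ⊆ Ω) (hC0 : 0 ≤ C)
    (hC1 : ∀ x ∈ ball x₀ r, ‖fderiv ℝ N x‖ ≤ C)
    (hC2 : ∀ x ∈ ball x₀ r, ‖fderiv ℝ (fderiv ℝ N) x‖ ≤ C)
    (hC3 : ∀ x ∈ ball x₀ r, ‖fderiv ℝ (fderiv ℝ (fderiv ℝ N)) x‖ ≤ C)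
    (hCr : C * r ≤ 1) {η : E} (hη : N x₀ η = η) {y h : V} (hy : y ∈ ball (0 : V) r)
    (hyh : y + h ∈ ball (0 : V) r) {u u₁ : ℝ → E} (hu : IsRayTransport N x₀ y η u)
    (hu₁ : IsRayTransport N x₀ (y + h) η u₁) {A : ℝ} (hA : ∀ t ∈ Icc (0 : ℝ) 1, ‖u t‖ ≤ A) :
    ‖u₁ 1 - u 1 - fderiv ℝ N (x₀ + y) h (u 1)‖ ≤
      (4 * C ^ 2 + 2 * C) * A * ‖h‖ ^ 2 * Real.exp 1 := by
  have hray := fun t (ht : t ∈ Icc (0 : ℝ) 1) => add_smul_mem_ball (x₀ := x₀) hy ht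
  have hray₁ := fun t (ht : t ∈ Icc (0 : ℝ) 1) => add_smul_mem_ball (x₀ := x₀) hyh ht
  have hyr : ‖y‖ < r := by simpa using hy
  have hyhr : ‖y + h‖ < r := by simpa using hyh
  have hy1 : ‖y‖ ≤ 1 := by linarith
  have hyh1 : ‖y + h‖ ≤ 1 := by linarith
  have hh1 : ‖h‖ ≤ 1 := by
    have : ‖h‖ ≤ ‖y + h‖ + ‖y‖ := by
      simpa using norm_sub_le (y + h) y
    linarith
  have hA0 : 0 ≤ A := (norm_nonneg _).trans (hA 0 (by simp))
  have hK : ∀ t ∈ Icc (0 : ℝ) 1, ‖fderiv ℝ N (x₀ + t • y) y‖ ≤ 1 := fun t ht =>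
    (ContinuousLinearMap.le_opNorm _ _).trans (le_trans (mul_le_mul (hC1 _ (hray t ht)) hyr.le
      (norm_nonneg _) hC0) hCr)
  have hK₁ : ∀ t ∈ Icc (0 : ℝ) 1, ‖fderiv ℝ N (x₀ + t • (y + h)) (y + h)‖ ≤ 1 := fun t ht =>
    (ContinuousLinearMap.le_opNorm _ _).trans (le_trans (mul_le_mul (hC1 _ (hray₁ t ht)) hyhr.le
      (norm_nonneg _) hC0) hCr)
  have hnor := fun t (ht : t ∈ Icc (0 : ℝ) 1) =>
    hu.normal hΩ hN hNN hη (fun t ht => hball (hray t ht)) hK ht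
  -- A first-order guess for the transport along the ray in direction `y + h`. At time 1 it is `u 1`
  -- plus the claimed derivative applied to `h`, so it suffices to show that it solves the equation
  -- up to an error quadratic in `h`.
  set v : ℝ → E := fun t => u t + t • fderiv ℝ N (x₀ + t • y) h (u t) with hv
  set v' : ℝ → E := fun t => fderiv ℝ N (x₀ + t • y) y (u t) +
    (fderiv ℝ N (x₀ + t • y) h (u t) + t • (fderiv ℝ (fderiv ℝ N) (x₀ + t • y) y h (u t) +
      fderiv ℝ N (x₀ + t • y) h (fderiv ℝ N (x₀ + t • y) y (u t)))) with hv'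
  have hvd : ∀ t ∈ Icc (0 : ℝ) 1, HasDerivWithinAt v (v' t) (Icc 0 1) t := by
    intro t ht
    have h1 : HasDerivWithinAt (fun t : ℝ => fderiv ℝ N (x₀ + t • y))
        (fderiv ℝ (fderiv ℝ N) (x₀ + t • y) y) (Icc 0 1) t :=
      ((hasFDerivAt_of_contDiffOn (contDiffOn_fderiv hN hΩ) hΩ
        (hball (hray t ht))).comp_hasDerivAt t (hasDerivAt_ray x₀ y t)).hasDerivWithinAt
    have h2 := (h1.clm_apply (hasDerivWithinAt_const t (Icc 0 1) h)).clm_apply (hu.2 t ht)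
    refine ((hu.2 t ht).add ((hasDerivWithinAt_id t _).smul h2)).congr_deriv ?_
    simp [hv', add_comm]
  set ε := (4 * C ^ 2 + 2 * C) * A * ‖h‖ ^ 2 with hε
  have herr : ∀ t ∈ Icc (0 : ℝ) 1,
      ‖fderiv ℝ N (x₀ + t • (y + h)) (y + h) (v t) - v' t‖ ≤ ε := by
    intro t ht
    have hz := hball (hray t ht)
    set G := fderiv ℝ N (x₀ + t • y) with hG
    set D := fderiv ℝ (fderiv ℝ N) (x₀ + t • y) with hD
    set R := fderiv ℝ N (x₀ + t • (y + h)) - G - D (t • h) with hR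
    have hRn : ‖R‖ ≤ C * ‖h‖ ^ 2 := by
      have := norm_sub_sub_fderiv_le (contDiffOn_fderiv hN hΩ) hΩ (convex_ball x₀ r) hball hC0 hC3
        (hray t ht) (hray₁ t ht)
      have e1 : x₀ + t • (y + h) - (x₀ + t • y) = t • h := by rw [smul_add]; abel
      rw [e1] at this
      refine this.trans (mul_le_mul_of_nonneg_left ?_ hC0)
      rw [norm_smul, Real.norm_of_nonneg ht.1]
      exact pow_le_pow_left₀ (mul_nonneg ht.1 (norm_nonneg _))
        (mul_le_of_le_one_left (norm_nonneg _) ht.2) 2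
    -- Flatness enters here. Together with the symmetry of the second derivative of `N`, it removes
    -- every term of first order in `h` from the error.
    have hcomm : G y (G h (u t)) = G h (G y (u t)) :=
      fderiv_projection_comm hΩ hN hNN hflat hz y h (hnor t ht)
    have hDs : D y h = D h y := fderiv_fderiv_comm hN hΩ hz y h
    have hdecomp : fderiv ℝ N (x₀ + t • (y + h)) (y + h) (v t) - v' t =
        t • G h (G h (u t)) + t • D h y (t • G h (u t)) + t • D h h (v t) + R (y + h) (v t) := by
      have e2 : fderiv ℝ N (x₀ + t • (y + h)) = G + t • D h + R := by
        rw [hR, map_smul]; abel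
      rw [e2]
      simp only [hv, hv', map_add, map_smul, add_apply, smul_apply, hDs, hcomm, smul_add, ← hG,
        ← hD]
      abel
    have hGh : ‖G h (u t)‖ ≤ C * ‖h‖ * A :=
      (G h).le_of_opNorm_le_of_le (G.le_of_opNorm_le (hC1 _ (hray t ht)) h) (hA t ht)
    have hGhh : ‖G h (G h (u t))‖ ≤ C * ‖h‖ * (C * ‖h‖ * A) :=
      (G h).le_of_opNorm_le_of_le (G.le_of_opNorm_le (hC1 _ (hray t ht)) h) hGh
    have hts : ∀ z : E, ‖t • z‖ ≤ ‖z‖ := fun z => by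
      rw [norm_smul, Real.norm_of_nonneg ht.1]
      exact mul_le_of_le_one_left (norm_nonneg _) ht.2
    have hvn : ‖v t‖ ≤ A + C * A := by
      refine (norm_add_le _ _).trans (add_le_add (hA t ht) ((hts _).trans (hGh.trans ?_)))
      rw [mul_right_comm]
      exact mul_le_of_le_one_right (by positivity) hh1
    have hDb : ∀ z : V, ‖D h z‖ ≤ C * ‖h‖ * ‖z‖ := fun z =>
      (D h).le_of_opNorm_le (D.le_of_opNorm_le (hC2 _ (hray t ht)) h) z
    have b2 : ‖D h y (t • G h (u t))‖ ≤ C * ‖h‖ * 1 * (C * ‖h‖ * A) :=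
      (D h y).le_of_opNorm_le_of_le ((hDb y).trans (by gcongr)) ((hts _).trans hGh)
    have b3 : ‖D h h (v t)‖ ≤ C * ‖h‖ * ‖h‖ * (A + C * A) :=
      (D h h).le_of_opNorm_le_of_le (hDb h) hvn
    have b4 : ‖R (y + h) (v t)‖ ≤ C * ‖h‖ ^ 2 * 1 * (A + C * A) :=
      (R (y + h)).le_of_opNorm_le_of_le (R.le_of_opNorm_le_of_le hRn hyh1) hvn
    rw [hdecomp]
    refine (norm_add_le _ _).trans ?_
    refine (add_le_add ((norm_add_le _ _).trans (add_le_add ((norm_add_le _ _).trans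
      (add_le_add ((hts _).trans hGhh) ((hts _).trans b2))) ((hts _).trans b3))) b4).trans ?_
    rw [hε]
    apply le_of_eq; ring
  have hε0 : 0 ≤ ε := by positivity
  have hgr := norm_le_gronwallBound_of_norm_deriv_right_le (f := fun t => u₁ t - v t) (δ := 0)
    (K := 1) (ε := ε) (a := 0) (b := 1)
    (fun t ht => ((hu₁.2 t ht).sub (hvd t ht)).continuousWithinAt)
    (fun t ht => hasDerivWithinAt_Ici_of_Icc ht
      ((hu₁.2 t (Ico_subset_Icc_self ht)).sub (hvd t (Ico_subset_Icc_self ht))))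
    (by simp [hv, hu.1, hu₁.1])
    (fun t ht => by
      have ht' := Ico_subset_Icc_self ht
      have e3 : fderiv ℝ N (x₀ + t • (y + h)) (y + h) (u₁ t) - v' t =
          fderiv ℝ N (x₀ + t • (y + h)) (y + h) (u₁ t - v t) +
            (fderiv ℝ N (x₀ + t • (y + h)) (y + h) (v t) - v' t) := by
        rw [map_sub]; abel
      rw [e3]
      exact (norm_add_le _ _).trans (add_le_add
        ((fderiv ℝ N (x₀ + t • (y + h)) (y + h)).le_of_opNorm_le (hK₁ t ht') _) (herr t ht')))
    1 (by simp)
  rw [gronwallBound_of_K_ne_0 one_ne_zero] at hgr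
  have hv1 : v 1 = u 1 + fderiv ℝ N (x₀ + y) h (u 1) := by simp [hv]
  rw [hv1, ← sub_sub] at hgr
  refine hgr.trans ?_
  simp only [zero_mul, zero_add, div_one, sub_zero, mul_one]
  exact mul_le_mul_of_nonneg_left (by linarith) hε0

/-- Local existence of parallel sections of the image of a family of projections `N` whose induced
connection is flat. -/
theorem exists_parallel_section [CompleteSpace E] (hΩ : IsOpen Ω) (hN : ContDiffOn ℝ ∞ N Ω)
    (hNN : ∀ x ∈ Ω, ∀ y, N x (N x y) = N x y)
    (hflat : ∀ x ∈ Ω, ∀ v w y,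
      N x (fderiv ℝ N x v (fderiv ℝ N x w y)) = N x (fderiv ℝ N x w (fderiv ℝ N x v y)))
    {x₀ : V} (hx₀ : x₀ ∈ Ω) {η : E} (hη : N x₀ η = η) :
    ∃ r > 0, ball x₀ r ⊆ Ω ∧ ∃ ξ : V → E, ContDiffOn ℝ ∞ ξ (ball x₀ r) ∧ ξ x₀ = η ∧
      ∀ x ∈ ball x₀ r, N x (ξ x) = ξ x ∧ ∀ v, fderiv ℝ ξ x v = fderiv ℝ N x v (ξ x) := by
  have hN1 := contDiffOn_fderiv hN hΩ
  have hN2 := contDiffOn_fderiv hN1 hΩ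
  have hN3 := contDiffOn_fderiv hN2 hΩ
  set C := ‖fderiv ℝ N x₀‖ + ‖fderiv ℝ (fderiv ℝ N) x₀‖ +
    ‖fderiv ℝ (fderiv ℝ (fderiv ℝ N)) x₀‖ + 1 with hCdef
  have hC0 : 0 < C := by positivity
  have n1 := norm_nonneg (fderiv ℝ N x₀)
  have n2 := norm_nonneg (fderiv ℝ (fderiv ℝ N) x₀)
  have n3 := norm_nonneg (fderiv ℝ (fderiv ℝ (fderiv ℝ N)) x₀)
  have ev1 := (hN1.continuousOn.continuousAt (hΩ.mem_nhds hx₀)).norm.eventually_lt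
    (continuousAt_const (y := C)) (by rw [hCdef]; linarith)
  have ev2 := (hN2.continuousOn.continuousAt (hΩ.mem_nhds hx₀)).norm.eventually_lt
    (continuousAt_const (y := C)) (by rw [hCdef]; linarith)
  have ev3 := (hN3.continuousOn.continuousAt (hΩ.mem_nhds hx₀)).norm.eventually_lt
    (continuousAt_const (y := C)) (by rw [hCdef]; linarith)
  obtain ⟨r₀, hr₀, hb⟩ := Metric.eventually_nhds_iff_ball.1
    (((hΩ.eventually_mem hx₀).and ev1).and (ev2.and ev3))
  -- The bound `1 / 2` makes `y`, `y + h` and `h` have norm at most 1; the last bound is the one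
  -- required by Picard–Lindelöf.
  set r := min r₀ (min (1 / 2) (1 / (C * (‖η‖ + 1)))) with hr
  have hrpos : 0 < r := by positivity
  have hrr₀ : ball x₀ r ⊆ ball x₀ r₀ := ball_subset_ball (min_le_left _ _)
  have hr2 : r ≤ 1 / 2 := (min_le_right _ _).trans (min_le_left _ _)
  have hCr' : C * r * (‖η‖ + 1) ≤ 1 := by
    have : r ≤ 1 / (C * (‖η‖ + 1)) := (min_le_right _ _).trans (min_le_right _ _)
    rw [le_div_iff₀ (by positivity)] at this
    linarith
  have hCr : C * r ≤ 1 :=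
    (le_mul_of_one_le_right (by positivity) (by linarith [norm_nonneg η])).trans hCr'
  have hball : ball x₀ r ⊆ Ω := fun x hx => (hb x (hrr₀ hx)).1.1
  have hC1 : ∀ x ∈ ball x₀ r, ‖fderiv ℝ N x‖ ≤ C := fun x hx => (hb x (hrr₀ hx)).1.2.le
  have hC2 : ∀ x ∈ ball x₀ r, ‖fderiv ℝ (fderiv ℝ N) x‖ ≤ C := fun x hx =>
    (hb x (hrr₀ hx)).2.1.le
  have hC3 : ∀ x ∈ ball x₀ r, ‖fderiv ℝ (fderiv ℝ (fderiv ℝ N)) x‖ ≤ C := fun x hx =>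
    (hb x (hrr₀ hx)).2.2.le
  choose! U hU using fun y (hy : y ∈ ball (0 : V) r) =>
    exists_isRayTransport hΩ hN hrpos hball hC1 η hCr' hy
  -- The section is transport along rays from `x₀`, evaluated at their ends.
  set ξ : V → E := fun x => U (x - x₀) 1 with hξ
  have hmem : ∀ x ∈ ball x₀ r, x - x₀ ∈ ball (0 : V) r := fun x hx => by
    simpa [dist_eq_norm] using hx
  have hder : ∀ x ∈ ball x₀ r, HasFDerivAt ξ ((fderiv ℝ N x).flip (ξ x)) x := by
    intro x hx
    have hux := hU _ (hmem x hx)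
    obtain ⟨A, hA⟩ := isCompact_Icc.exists_bound_of_continuousOn
      (f := U (x - x₀)) (s := Icc (0 : ℝ) 1) (fun t ht => (hux.2 t ht).continuousWithinAt)
    have hbig : (fun h => ξ (x + h) - ξ x - (fderiv ℝ N x).flip (ξ x) h) =O[𝓝 0]
        fun h : V => ‖h‖ ^ 2 := by
      refine Asymptotics.IsBigO.of_bound ((4 * C ^ 2 + 2 * C) * A * Real.exp 1) ?_
      have hnh : ∀ᶠ h in 𝓝 (0 : V), x + h ∈ ball x₀ r := by
        have : Filter.Tendsto (fun h : V => x + h) (𝓝 0) (𝓝 x) := by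
          simpa using (continuous_const_add x).tendsto (0 : V)
        exact this (isOpen_ball.mem_nhds hx)
      filter_upwards [hnh] with h hh
      have e : x + h - x₀ = (x - x₀) + h := by abel
      have hm := hmem _ hh
      have hu₁ := hU _ hm
      rw [e] at hm hu₁
      have := hux.norm_sub_fderiv_le hΩ hN hNN hflat hr2 hball hC0.le hC1 hC2 hC3 hCr hη (hmem x hx)
        hm hu₁ hA
      rw [add_sub_cancel] at this
      simp only [hξ, e, ContinuousLinearMap.flip_apply, norm_pow, norm_norm]
      refine this.trans (le_of_eq (by ring))
    rw [hasFDerivAt_iff_isLittleO_nhds_zero]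
    exact hbig.trans_isLittleO (Asymptotics.isLittleO_norm_pow_id one_lt_two)
  refine ⟨r, hrpos, hball, ξ, ?_, ?_, fun x hx => ⟨?_, fun v => by rw [(hder x hx).fderiv]; rfl⟩⟩
  -- Bootstrapping: the derivative of `ξ` is a smooth expression in `x` and `ξ x`, so each order of
  -- smoothness yields the next.
  · rw [contDiffOn_infty]
    intro k
    induction k with
    | zero => exact contDiffOn_zero.2 fun x hx => (hder x hx).continuousAt.continuousWithinAt
    | succ k ih =>
      push_cast
      rw [contDiffOn_succ_iff_fderiv_of_isOpen isOpen_ball]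
      refine ⟨fun x hx => (hder x hx).differentiableAt.differentiableWithinAt, by simp, ?_⟩
      have : ContDiffOn ℝ k (fun x => (fderiv ℝ N x).flip (ξ x)) (ball x₀ r) :=
        ((ContinuousLinearMap.flipₗᵢ ℝ V E E).contDiff.comp_contDiffOn
          ((hN1.mono hball).of_le (mod_cast le_top))).clm_apply ih
      exact this.congr fun x hx => (hder x hx).fderiv
  -- Along the constant ray the equation is `u' = 0`.
  · have h0 := hU 0 (mem_ball_self hrpos)
    have hc := constant_of_has_deriv_right_zero (f := U 0) (a := 0) (b := 1)
      (fun t ht => (h0.2 t ht).continuousWithinAt)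
      (fun t ht => by
        have := hasDerivWithinAt_Ici_of_Icc ht (h0.2 t (Ico_subset_Icc_self ht))
        simpa using this) 1 (by simp)
    simp only [hξ, sub_self]
    rw [hc, h0.1]
  · have hux := hU _ (hmem x hx)
    have hxm := hmem x hx
    have := hux.normal hΩ hN hNN hη (K := C * r)
      (fun t ht => hball (add_smul_mem_ball hxm ht))
      (fun t ht => (ContinuousLinearMap.le_opNorm _ _).trans (mul_le_mul
        (hC1 _ (add_smul_mem_ball hxm ht)) (mem_ball_zero_iff.1 hxm).le
        (norm_nonneg _) hC0.le)) (t := 1) (by simp)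
    simpa [hξ] using this

end Transport

/-! ### Eigenbases of self-adjoint endomorphisms. -/

section Eigenbasis

variable {V : Type*} [AddCommGroup V] [Module ℝ V]

/-- An endomorphism that is symmetric for a positive definite form has an orthonormal basis of
eigenvectors. -/
theorem exists_orthonormal_eigenbasis [FiniteDimensional ℝ V] {n : ℕ} (hn : Module.finrank ℝ V = n)
    (g : V →ₗ[ℝ] V →ₗ[ℝ] ℝ) (hsymm : ∀ v w, g v w = g w v) (hnonneg : ∀ v, 0 ≤ g v v)
    (hdef : ∀ v, g v v = 0 → v = 0) (A : V →ₗ[ℝ] V) (hA : ∀ v w, g (A v) w = g v (A w)) :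
    ∃ (e : Module.Basis (Fin n) ℝ V) (l : Fin n → ℝ),
      (∀ i j, g (e i) (e j) = if i = j then 1 else 0) ∧ ∀ i, A (e i) = l i • e i := by
  let core : InnerProductSpace.Core ℝ V :=
    { inner := fun v w => g v w
      conj_inner_symm := fun v w => by simp [hsymm v w]
      re_inner_nonneg := fun v => by simpa using hnonneg v
      add_left := fun u v w => by simp
      smul_left := fun u v r => by simp
      definite := fun v h => hdef v h }
  let : NormedAddCommGroup V := core.toNormedAddCommGroup
  let : InnerProductSpace ℝ V := InnerProductSpace.ofCore core.toCore
  have hinner : ∀ v w : V, inner ℝ v w = g v w := fun _ _ => rfl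
  have hs : A.IsSymmetric := fun v w => hA v w
  refine ⟨(hs.eigenvectorBasis hn).toBasis, hs.eigenvalues hn, fun i j => ?_, fun i => ?_⟩
  · rw [← hinner]
    simpa using orthonormal_iff_ite.1 (hs.eigenvectorBasis hn).orthonormal i j
  · simp

theorem charpoly_roots_of_eigenbasis [Module.Finite ℝ V] [Module.Free ℝ V] {n : ℕ} (e : Module.Basis (Fin n) ℝ V) (l : Fin n → ℝ)
    (A : V →ₗ[ℝ] V) (h : ∀ i, A (e i) = l i • e i) :
    A.charpoly.roots = Finset.univ.val.map l := by
  have hM : LinearMap.toMatrix e e A = Matrix.diagonal l := by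
    ext i j
    rw [LinearMap.toMatrix_apply, h, map_smul, Finsupp.smul_apply, Module.Basis.repr_self,
      Matrix.diagonal_apply, Finsupp.single_apply]
    rcases eq_or_ne i j with rfl | hij
    · simp
    · simp [hij, Ne.symm hij]
  rw [← LinearMap.charpoly_toMatrix A e, hM, Matrix.charpoly_diagonal]
  have := Polynomial.roots_multiset_prod_X_sub_C (Finset.univ.val.map l)
  rwa [Multiset.map_map] at this

theorem aeval_eq_zero_of_eigenbasis {n : ℕ} (e : Module.Basis (Fin n) ℝ V) (l : Fin n → ℝ)
    (A : Module.End ℝ V) (h : ∀ i, A (e i) = l i • e i) (q : Polynomial ℝ)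
    (hq : ∀ i, q.eval (l i) = 0) : Polynomial.aeval A q = 0 := by
  refine e.ext fun i => ?_
  rw [Module.End.aeval_apply_of_hasEigenvector (μ := l i)
    ⟨Module.End.mem_eigenspace_iff.2 (h i), e.ne_zero i⟩, hq i, zero_smul, LinearMap.zero_apply]

end Eigenbasis

/-! ### Tangential projection by a smooth left inverse of the differential. -/

section LorentzLemmas

variable {m : ℕ}

theorem lorentzL_comm (x y : LorentzSpace m) : lorentzL m x y = lorentzL m y x :=
  lorentz_comm x y

/-- A vector that is orthogonal to itself and to a point of the hyperboloid is zero. -/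
theorem eq_zero_of_orthogonal {p y : LorentzSpace m} (hp : p ∈ hyperbolicSpace m)
    (hy : lorentzL m y p = 0) (h : lorentzL m y y = 0) : y = 0 :=
  (lorentz_self_nonneg_of_orthogonal hp hy).2 h

theorem eq_zero_of_normal_of_mem_tangent {V : Type*} [AddCommGroup V] [Module ℝ V]
    {p : LorentzSpace m} (hp : p ∈ hyperbolicSpace m) (J : V →ₗ[ℝ] LorentzSpace m)
    {c : ℝ} {v : V} {y : LorentzSpace m} (hy : y = c • p + J v) (hyp : lorentzL m y p = 0)
    (hyJ : ∀ w, lorentzL m y (J w) = 0) : y = 0 := by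
  refine eq_zero_of_orthogonal hp hyp ?_
  conv_lhs => enter [2]; rw [hy]
  simp [hyp, hyJ]

end LorentzLemmas

section LeftInverse

variable {n m : ℕ}

local notation "𝔼" => EuclideanSpace ℝ (Fin n)

/-- The Lorentzian adjoint of `J`. -/
noncomputable def lorentzAdj (J : 𝔼 →L[ℝ] LorentzSpace m) : LorentzSpace m →L[ℝ] 𝔼 :=
  ∑ i, (lorentzL m (J (EuclideanSpace.single i 1))).smulRight (EuclideanSpace.single i (1 : ℝ))

theorem inner_lorentzAdj (J : 𝔼 →L[ℝ] LorentzSpace m) (y : LorentzSpace m) (v : 𝔼) :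
    inner ℝ (lorentzAdj J y) v = lorentzL m y (J v) := by
  have hv : v = ∑ i, v i • (EuclideanSpace.single i (1 : ℝ) : 𝔼) := by
    simpa using ((EuclideanSpace.basisFun (Fin n) ℝ).sum_repr v).symm
  conv_rhs => rw [hv]
  simp only [lorentzAdj, sum_apply, ContinuousLinearMap.smulRight_apply, sum_inner,
    inner_smul_left, EuclideanSpace.inner_single_left, map_sum, map_smul, smul_eq_mul]
  refine Finset.sum_congr rfl fun i _ => ?_
  rw [lorentzL_comm]; simp [mul_comm]

/-- The left inverse `g⁻¹ J*` of the injective spacelike map `J`. -/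
noncomputable def leftInv (J : 𝔼 →L[ℝ] LorentzSpace m) : LorentzSpace m →L[ℝ] 𝔼 :=
  (Ring.inverse ((lorentzAdj J).comp J)).comp (lorentzAdj J)

theorem isUnit_adj_comp {J : 𝔼 →L[ℝ] LorentzSpace m}
    (hJ : ∀ v, lorentzL m (J v) (J v) = 0 → v = 0) : IsUnit ((lorentzAdj J).comp J) := by
  rw [ContinuousLinearMap.isUnit_iff_bijective]
  have hinj : Function.Injective ((lorentzAdj J).comp J) := by
    rw [injective_iff_map_eq_zero]
    intro v hv
    refine hJ v ?_
    rw [← inner_lorentzAdj]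
    have : lorentzAdj J (J v) = 0 := hv
    rw [this, inner_zero_left]
  exact ⟨hinj, LinearMap.surjective_of_injective
    (f := ((lorentzAdj J).comp J : 𝔼 →ₗ[ℝ] 𝔼)) hinj⟩

/-- Thus `J ∘ leftInv J` is the orthogonal projection onto the range of `J`. The formula through
`Ring.inverse` makes its smooth dependence on `J` visible. -/
theorem lorentzL_leftInv {J : 𝔼 →L[ℝ] LorentzSpace m}
    (hJ : ∀ v, lorentzL m (J v) (J v) = 0 → v = 0) (y : LorentzSpace m) (w : 𝔼) :
    lorentzL m (J (leftInv J y)) (J w) = lorentzL m y (J w) := by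
  have h := Ring.mul_inverse_cancel _ (isUnit_adj_comp hJ)
  have h1 : lorentzAdj J (J (leftInv J y)) = lorentzAdj J y :=
    DFunLike.congr_fun h (lorentzAdj J y)
  rw [← inner_lorentzAdj, h1, inner_lorentzAdj]

theorem leftInv_eq {J : 𝔼 →L[ℝ] LorentzSpace m}
    (hJ : ∀ v, lorentzL m (J v) (J v) = 0 → v = 0) {y : LorentzSpace m} {v : 𝔼}
    (h : ∀ w, lorentzL m (J v) (J w) = lorentzL m y (J w)) : leftInv J y = v := by
  rw [← sub_eq_zero]
  refine hJ _ ?_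
  conv_lhs => enter [1]; rw [map_sub]
  rw [map_sub, sub_apply, lorentzL_leftInv hJ, h, sub_self]

theorem contDiffOn_leftInv {Ω : Set 𝔼} {J : 𝔼 → 𝔼 →L[ℝ] LorentzSpace m}
    (hJs : ContDiffOn ℝ ∞ J Ω) (hJ : ∀ x ∈ Ω, ∀ v, lorentzL m (J x v) (J x v) = 0 → v = 0) :
    ContDiffOn ℝ ∞ (fun x => leftInv (J x)) Ω := by
  have hadj : ContDiffOn ℝ ∞ (fun x => lorentzAdj (J x)) Ω := by
    refine ContDiffOn.sum fun i _ => ?_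
    have h1 : ContDiffOn ℝ ∞ (fun x => lorentzL m (J x (EuclideanSpace.single i 1))) Ω :=
      (lorentzL m).contDiff.comp_contDiffOn (hJs.clm_apply contDiffOn_const)
    exact ((ContinuousLinearMap.smulRightL ℝ (LorentzSpace m) 𝔼).flip
      (EuclideanSpace.single i (1 : ℝ))).contDiff.comp_contDiffOn h1
  refine ContDiffOn.clm_comp (fun x hx => ?_) hadj
  obtain ⟨u, hu⟩ := isUnit_adj_comp (hJ x hx)
  have := contDiffAt_ringInverse ℝ (n := ∞) u
  rw [hu] at this
  exact this.comp_contDiffWithinAt x ((hadj.clm_comp hJs) x hx)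

end LeftInverse

/-! ### Immersions of open subsets of `ℝⁿ` and their normal projection. -/

section Immersion

variable {n m : ℕ}

local notation "𝔼" => EuclideanSpace ℝ (Fin n)

/-- `F` is a smooth immersion of the open set `Ω` of `ℝⁿ` into `ℍ^m(-1)`. -/
structure IsHypImmersionOn (F : EuclideanSpace ℝ (Fin n) → LorentzSpace m)
    (Ω : Set (EuclideanSpace ℝ (Fin n))) : Prop where
  isOpen : IsOpen Ω
  smooth : ContDiffOn ℝ ∞ F Ω
  mem : ∀ x ∈ Ω, F x ∈ hyperbolicSpace m
  injective : ∀ x ∈ Ω, Function.Injective (fderiv ℝ F x)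

/-- Orthogonal projection onto the normal space of `F` at `x`. -/
noncomputable def normalL (F : 𝔼 → LorentzSpace m) (x : 𝔼) : LorentzSpace m →L[ℝ] LorentzSpace m :=
  ContinuousLinearMap.id ℝ _ + (lorentzL m (F x)).smulRight (F x) -
    (fderiv ℝ F x).comp (leftInv (fderiv ℝ F x))

namespace IsHypImmersionOn

variable {F : EuclideanSpace ℝ (Fin n) → LorentzSpace m} {Ω : Set (EuclideanSpace ℝ (Fin n))}
  {x : EuclideanSpace ℝ (Fin n)}

theorem mono (hF : IsHypImmersionOn F Ω) {Ω' : Set 𝔼} (ho : IsOpen Ω') (h : Ω' ⊆ Ω) :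
    IsHypImmersionOn F Ω' :=
  ⟨ho, hF.smooth.mono h, fun x hx => hF.mem x (h hx), fun x hx => hF.injective x (h hx)⟩

theorem lorentzL_self (hF : IsHypImmersionOn F Ω) (hx : x ∈ Ω) : lorentzL m (F x) (F x) = -1 :=
  (hF.mem x hx).1

theorem lorentzL_fderiv (hF : IsHypImmersionOn F Ω) (hx : x ∈ Ω) (v : 𝔼) :
    lorentzL m (fderiv ℝ F x v) (F x) = 0 := by
  have d := hasFDerivAt_of_contDiffOn hF.smooth hF.isOpen hx
  have h := ((lorentzL m).hasFDerivAt.comp x d).clm_apply d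
  have h0 := DFunLike.congr_fun (hasFDerivAt_eq_zero_of_eqOn hF.isOpen hx (h.add_const (1 : ℝ))
    (fun y hy => by simp [hF.lorentzL_self hy])) v
  simp at h0
  rw [lorentzL_comm (F x)] at h0
  linarith

theorem eq_zero_of_lorentzL_self (hF : IsHypImmersionOn F Ω) (hx : x ∈ Ω) (v : 𝔼)
    (h : lorentzL m (fderiv ℝ F x v) (fderiv ℝ F x v) = 0) : v = 0 := by
  refine hF.injective x hx ?_
  rw [map_zero]
  exact eq_zero_of_orthogonal (hF.mem x hx) (hF.lorentzL_fderiv hx v) h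

theorem lorentzL_self_nonneg (hF : IsHypImmersionOn F Ω) (hx : x ∈ Ω) (v : 𝔼) :
    0 ≤ lorentzL m (fderiv ℝ F x v) (fderiv ℝ F x v) :=
  (lorentz_self_nonneg_of_orthogonal (hF.mem x hx) (hF.lorentzL_fderiv hx v)).1

theorem normalL_apply (y : LorentzSpace m) : normalL F x y =
    y + lorentzL m y (F x) • F x - fderiv ℝ F x (leftInv (fderiv ℝ F x) y) := by
  rw [lorentzL_comm]; rfl

theorem lorentzL_normalL_fderiv (hF : IsHypImmersionOn F Ω) (hx : x ∈ Ω) (y : LorentzSpace m)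
    (v : 𝔼) : lorentzL m (normalL F x y) (fderiv ℝ F x v) = 0 := by
  rw [normalL_apply, map_sub, map_add, map_smul, sub_apply, add_apply, smul_apply,
    lorentzL_leftInv (hF.eq_zero_of_lorentzL_self hx), lorentzL_comm (F x), hF.lorentzL_fderiv hx]
  simp

theorem lorentzL_normalL_self (hF : IsHypImmersionOn F Ω) (hx : x ∈ Ω) (y : LorentzSpace m) :
    lorentzL m (normalL F x y) (F x) = 0 := by
  rw [normalL_apply, map_sub, map_add, map_smul, sub_apply, add_apply, smul_apply,
    hF.lorentzL_fderiv hx, hF.lorentzL_self hx]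
  simp

/-- The normal projection is characterized by its kernel and its image. -/
theorem normalL_eq (hF : IsHypImmersionOn F Ω) (hx : x ∈ Ω) {y z : LorentzSpace m} {c : ℝ} {v : 𝔼}
    (hzF : lorentzL m z (F x) = 0) (hzJ : ∀ w, lorentzL m z (fderiv ℝ F x w) = 0)
    (hyz : y - z = c • F x + fderiv ℝ F x v) : normalL F x y = z := by
  rw [← sub_eq_zero]
  refine eq_zero_of_normal_of_mem_tangent (hF.mem x hx) (fderiv ℝ F x : 𝔼 →ₗ[ℝ] LorentzSpace m)
    (c := c + lorentzL m y (F x)) (v := v - leftInv (fderiv ℝ F x) y) ?_ ?_ ?_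
  · have : y = z + (c • F x + fderiv ℝ F x v) := by rw [← hyz]; abel
    rw [normalL_apply, ContinuousLinearMap.coe_coe, map_sub, add_smul]
    nth_rewrite 1 [this]
    abel
  · rw [map_sub, sub_apply, hF.lorentzL_normalL_self hx, hzF, sub_zero]
  · intro w
    rw [map_sub, sub_apply, ContinuousLinearMap.coe_coe, hF.lorentzL_normalL_fderiv hx, hzJ,
      sub_zero]

theorem normalL_of_normal (hF : IsHypImmersionOn F Ω) (hx : x ∈ Ω) {z : LorentzSpace m}
    (hzF : lorentzL m z (F x) = 0) (hzJ : ∀ w, lorentzL m z (fderiv ℝ F x w) = 0) :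
    normalL F x z = z :=
  hF.normalL_eq hx hzF hzJ (c := 0) (v := 0) (by simp)

theorem normalL_normalL (hF : IsHypImmersionOn F Ω) (hx : x ∈ Ω) (y : LorentzSpace m) :
    normalL F x (normalL F x y) = normalL F x y :=
  hF.normalL_of_normal hx (hF.lorentzL_normalL_self hx y) (hF.lorentzL_normalL_fderiv hx y)

theorem contDiffOn_leftInv (hF : IsHypImmersionOn F Ω) :
    ContDiffOn ℝ ∞ (fun x => leftInv (fderiv ℝ F x)) Ω :=
  HypSubmanifold.contDiffOn_leftInv (contDiffOn_fderiv hF.smooth hF.isOpen)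
    fun _ hx => hF.eq_zero_of_lorentzL_self hx

theorem contDiffOn_normalL (hF : IsHypImmersionOn F Ω) : ContDiffOn ℝ ∞ (normalL F) Ω := by
  refine (contDiffOn_const.add ?_).sub
    ((contDiffOn_fderiv hF.smooth hF.isOpen).clm_comp hF.contDiffOn_leftInv)
  have h1 : ContDiffOn ℝ ∞ (fun x => lorentzL m (F x)) Ω :=
    (lorentzL m).contDiff.comp_contDiffOn hF.smooth
  exact ((ContinuousLinearMap.smulRightL ℝ (LorentzSpace m) (LorentzSpace m)).contDiff.comp_contDiffOn
    h1).clm_apply hF.smooth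

end IsHypImmersionOn

end Immersion

/-! ### Shape operators of parallel fields and the minimality argument. -/

section ParallelField

variable {n m : ℕ}

local notation "𝔼" => EuclideanSpace ℝ (Fin n)

/-- `ξ` is a parallel normal field of the immersion `F` over `Ω`. -/
structure IsParallelOn (F ξ : EuclideanSpace ℝ (Fin n) → LorentzSpace m)
    (Ω : Set (EuclideanSpace ℝ (Fin n))) : Prop where
  smooth : ContDiffOn ℝ ∞ ξ Ω
  orth_self : ∀ x ∈ Ω, lorentzL m (ξ x) (F x) = 0
  orth_fderiv : ∀ x ∈ Ω, ∀ v, lorentzL m (ξ x) (fderiv ℝ F x v) = 0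
  parallel : ∀ x ∈ Ω, ∀ v, normalL F x (fderiv ℝ ξ x v) = 0

/-- The shape operator in the direction of the normal field `ξ`. -/
noncomputable def shapeL (F ξ : 𝔼 → LorentzSpace m) (x : 𝔼) : 𝔼 →L[ℝ] 𝔼 :=
  -((leftInv (fderiv ℝ F x)).comp (fderiv ℝ ξ x))

variable {F ξ : EuclideanSpace ℝ (Fin n) → LorentzSpace m} {Ω : Set (EuclideanSpace ℝ (Fin n))}
  {x : EuclideanSpace ℝ (Fin n)}

namespace IsHypImmersionOn

/-- Differentiate `⟨ξ, dF w⟩ = 0`. The field need not be parallel, because the pairing with `dF w`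
sees only the tangential part of `dξ`. -/
theorem shapeL_spec (hF : IsHypImmersionOn F Ω) (hξs : ContDiffOn ℝ ∞ ξ Ω)
    (hξ : ∀ x ∈ Ω, ∀ v, lorentzL m (ξ x) (fderiv ℝ F x v) = 0) (hx : x ∈ Ω) (v w : 𝔼) :
    lorentzL m (fderiv ℝ F x (shapeL F ξ x v)) (fderiv ℝ F x w) =
      lorentzL m (fderiv ℝ (fderiv ℝ F) x v w) (ξ x) := by
  have hsh : fderiv ℝ F x (shapeL F ξ x v) =
      -fderiv ℝ F x (leftInv (fderiv ℝ F x) (fderiv ℝ ξ x v)) := by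
    simp [shapeL]
  rw [hsh, map_neg, neg_apply, lorentzL_leftInv (hF.eq_zero_of_lorentzL_self hx)]
  have h := ((lorentzL m).hasFDerivAt.comp x
    (hasFDerivAt_of_contDiffOn hξs hF.isOpen hx)).clm_apply
      ((hasFDerivAt_of_contDiffOn (contDiffOn_fderiv hF.smooth hF.isOpen) hF.isOpen hx).clm_apply
        (hasFDerivAt_const w x))
  have h0 := DFunLike.congr_fun (hasFDerivAt_eq_zero_of_eqOn hF.isOpen hx h
    (fun y hy => hξ y hy w)) v
  simp at h0
  rw [lorentzL_comm _ (ξ x)]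
  linarith

theorem shapeL_symm (hF : IsHypImmersionOn F Ω) (hξs : ContDiffOn ℝ ∞ ξ Ω)
    (hξ : ∀ x ∈ Ω, ∀ v, lorentzL m (ξ x) (fderiv ℝ F x v) = 0) (hx : x ∈ Ω) (v w : 𝔼) :
    lorentzL m (fderiv ℝ F x (shapeL F ξ x v)) (fderiv ℝ F x w) =
      lorentzL m (fderiv ℝ F x v) (fderiv ℝ F x (shapeL F ξ x w)) := by
  rw [hF.shapeL_spec hξs hξ hx, lorentzL_comm (fderiv ℝ F x v), hF.shapeL_spec hξs hξ hx,
    fderiv_fderiv_comm hF.smooth hF.isOpen hx]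

/-- Weingarten equation for a parallel normal field. -/
theorem fderiv_parallel (hF : IsHypImmersionOn F Ω) (hξ : IsParallelOn F ξ Ω) (hx : x ∈ Ω)
    (v : 𝔼) : fderiv ℝ ξ x v = -fderiv ℝ F x (shapeL F ξ x v) := by
  have d := hasFDerivAt_of_contDiffOn hξ.smooth hF.isOpen hx
  have dF := hasFDerivAt_of_contDiffOn hF.smooth hF.isOpen hx
  have h := ((lorentzL m).hasFDerivAt.comp x d).clm_apply dF
  have h0 := DFunLike.congr_fun (hasFDerivAt_eq_zero_of_eqOn hF.isOpen hx h
    (fun y hy => hξ.orth_self y hy)) v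
  simp [hξ.orth_fderiv x hx] at h0
  have hp := hξ.parallel x hx v
  rw [IsHypImmersionOn.normalL_apply, h0, zero_smul, add_zero, sub_eq_zero] at hp
  rw [hp]
  simp only [shapeL, neg_apply, ContinuousLinearMap.comp_apply, map_neg, neg_neg]

theorem exists_eigenbasis (hF : IsHypImmersionOn F Ω) (hξs : ContDiffOn ℝ ∞ ξ Ω)
    (hξ : ∀ x ∈ Ω, ∀ v, lorentzL m (ξ x) (fderiv ℝ F x v) = 0) (hx : x ∈ Ω) :
    ∃ (e : Module.Basis (Fin n) ℝ (EuclideanSpace ℝ (Fin n))) (l : Fin n → ℝ),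
      (∀ i j, lorentzL m (fderiv ℝ F x (e i)) (fderiv ℝ F x (e j)) = if i = j then 1 else 0) ∧
      ∀ i, shapeL F ξ x (e i) = l i • e i := by
  let J : 𝔼 →ₗ[ℝ] LorentzSpace m := (fderiv ℝ F x : 𝔼 →ₗ[ℝ] LorentzSpace m)
  let g : 𝔼 →ₗ[ℝ] 𝔼 →ₗ[ℝ] ℝ := LinearMap.mk₂ ℝ (fun v w => lorentzL m (J v) (J w))
    (by simp) (by simp) (by simp) (by simp)
  exact exists_orthonormal_eigenbasis (by simp) g (fun v w => lorentzL_comm _ _)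
    (fun v => hF.lorentzL_self_nonneg hx v) (fun v => hF.eq_zero_of_lorentzL_self hx v)
    (shapeL F ξ x : 𝔼 →ₗ[ℝ] 𝔼) (fun v w => hF.shapeL_symm hξs hξ hx v w)

theorem contDiffOn_shapeL (hF : IsHypImmersionOn F Ω) (hξs : ContDiffOn ℝ ∞ ξ Ω) :
    ContDiffOn ℝ ∞ (shapeL F ξ) Ω :=
  (hF.contDiffOn_leftInv.clm_comp (contDiffOn_fderiv hξs hF.isOpen)).neg

theorem contDiffOn_aeval {A : 𝔼 → 𝔼 →L[ℝ] 𝔼} (hA : ContDiffOn ℝ ∞ A Ω) (q : Polynomial ℝ) :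
    ContDiffOn ℝ ∞ (fun x => Polynomial.aeval (A x) q) Ω := by
  simp only [Polynomial.aeval_eq_sum_range]
  exact ContDiffOn.sum fun i _ => (hA.pow i).const_smul _

/-- If the eigenvalues of the shape operator are constant, then its eigenvectors extend to smooth
fields of eigenvectors. -/
theorem exists_eigenfield (hF : IsHypImmersionOn F Ω) (hξs : ContDiffOn ℝ ∞ ξ Ω)
    (hξ : ∀ x ∈ Ω, ∀ v, lorentzL m (ξ x) (fderiv ℝ F x v) = 0) {x₀ : 𝔼}
    (hconst : ∀ x ∈ Ω, (shapeL F ξ x : 𝔼 →ₗ[ℝ] 𝔼).charpoly.roots =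
      (shapeL F ξ x₀ : 𝔼 →ₗ[ℝ] 𝔼).charpoly.roots)
    {v : 𝔼} {c : ℝ} (hv : shapeL F ξ x₀ v = c • v) :
    ∃ β : EuclideanSpace ℝ (Fin n) → EuclideanSpace ℝ (Fin n), ContDiffOn ℝ ∞ β Ω ∧ β x₀ = v ∧
      ∀ x ∈ Ω, shapeL F ξ x (β x) = c • β x := by
  classical
  rcases eq_or_ne v 0 with rfl | hv0
  · exact ⟨fun _ => 0, contDiffOn_const, rfl, fun x _ => by simp⟩
  set s : Finset ℝ := (shapeL F ξ x₀ : 𝔼 →ₗ[ℝ] 𝔼).charpoly.roots.toFinset with hs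
  -- Up to the factor `q.eval c`, evaluating `q` at the shape operator projects onto the eigenspace
  -- of `c`. Since the spectrum is constant, one polynomial serves at every point, and the
  -- projection is smooth.
  set q : Polynomial ℝ := ∏ μ ∈ s.erase c, (Polynomial.X - Polynomial.C μ) with hq
  have hqc : q.eval c ≠ 0 := by
    rw [hq, Polynomial.eval_prod, Finset.prod_ne_zero_iff]
    intro μ hμ
    simpa using sub_ne_zero.2 (Finset.ne_of_mem_erase hμ).symm
  have hcoe : ∀ (B : 𝔼 →L[ℝ] 𝔼) (p : Polynomial ℝ) (w : 𝔼),
      (Polynomial.aeval B p) w = (Polynomial.aeval (B : Module.End ℝ 𝔼) p) w := by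
    intro B p w
    let φ : (𝔼 →L[ℝ] 𝔼) →ₐ[ℝ] Module.End ℝ 𝔼 :=
      { ContinuousLinearMap.toLinearMapRingHom with commutes' := fun _ => rfl }
    exact (DFunLike.congr_fun (Polynomial.aeval_algHom_apply φ B p) w).symm
  refine ⟨fun x => (q.eval c)⁻¹ • (Polynomial.aeval (shapeL F ξ x) q) v,
    ((contDiffOn_aeval (hF.contDiffOn_shapeL hξs) q).clm_apply contDiffOn_const).const_smul _,
    ?_, fun x hx => ?_⟩
  · beta_reduce
    rw [hcoe, Module.End.aeval_apply_of_hasEigenvector (μ := c)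
      ⟨Module.End.mem_eigenspace_iff.2 hv, hv0⟩, smul_smul, inv_mul_cancel₀ hqc, one_smul]
  · obtain ⟨e, l, -, hl⟩ := hF.exists_eigenbasis hξs hξ hx
    have hroots := charpoly_roots_of_eigenbasis e l (shapeL F ξ x : 𝔼 →ₗ[ℝ] 𝔼) hl
    have hmem : ∀ i, l i ∈ s := by
      intro i
      rw [hs, Multiset.mem_toFinset, ← hconst x hx, hroots]
      exact Multiset.mem_map_of_mem l (Finset.mem_univ i)
    -- `(X - c) * q` vanishes on the common spectrum, so it annihilates the diagonalizable shape
    -- operator.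
    have h0 := aeval_eq_zero_of_eigenbasis e l (shapeL F ξ x : Module.End ℝ 𝔼) hl
      ((Polynomial.X - Polynomial.C c) * q) (fun i => by
        rw [Polynomial.eval_mul]
        by_cases hic : l i = c
        · simp [hic]
        · rw [hq, Polynomial.eval_prod,
            Finset.prod_eq_zero (Finset.mem_erase.2 ⟨hic, hmem i⟩) (by simp), mul_zero])
    have h1 := DFunLike.congr_fun h0 v
    rw [map_mul, map_sub, Polynomial.aeval_X, Polynomial.aeval_C, Module.End.mul_apply,
      LinearMap.sub_apply, Module.algebraMap_end_apply, LinearMap.zero_apply, sub_eq_zero] at h1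
    rw [map_smul, smul_comm c, hcoe]
    congr 1

/-- This operator is the shape operator extended by zero to the normal directions, the position
vector included. Acting on a fixed vector space, it can be differentiated without a connection on
the tangent bundle. -/
theorem contDiffOn_ambientShape (hF : IsHypImmersionOn F Ω) (hξs : ContDiffOn ℝ ∞ ξ Ω) :
    ContDiffOn ℝ ∞ (fun x => -((fderiv ℝ ξ x).comp (leftInv (fderiv ℝ F x)))) Ω :=
  ((contDiffOn_fderiv hξs hF.isOpen).clm_comp hF.contDiffOn_leftInv).neg

/-- The sum of `⟨F_ii^⊥, F_jj^⊥⟩` over pairs of principal directions with distinct principal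
curvatures vanishes. -/
theorem sum_principal_products_eq_zero (hF : IsHypImmersionOn F Ω) (hξ : IsParallelOn F ξ Ω)
    {x₀ : 𝔼} (hx₀ : x₀ ∈ Ω)
    (hconst : ∀ x ∈ Ω, (shapeL F ξ x : 𝔼 →ₗ[ℝ] 𝔼).charpoly.roots =
      (shapeL F ξ x₀ : 𝔼 →ₗ[ℝ] 𝔼).charpoly.roots)
    (e : Module.Basis (Fin n) ℝ (EuclideanSpace ℝ (Fin n))) (l : Fin n → ℝ)
    (horth : ∀ i j, lorentzL m (fderiv ℝ F x₀ (e i)) (fderiv ℝ F x₀ (e j)) =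
      if i = j then 1 else 0)
    (heig : ∀ i, shapeL F ξ x₀ (e i) = l i • e i) :
    ∑ i, ∑ j, (if l i = l j then 0 else
      lorentzL m (orthPart (lorentzL m) (fun c => fderiv ℝ F x₀ (e c))
        (fderiv ℝ (fderiv ℝ F) x₀ (e i) (e i)))
        (orthPart (lorentzL m) (fun c => fderiv ℝ F x₀ (e c))
          (fderiv ℝ (fderiv ℝ F) x₀ (e j) (e j)))) = 0 := by
  choose β hβs hβx hβ using fun i =>
    hF.exists_eigenfield hξ.smooth hξ.orth_fderiv hconst (heig i)
  have hleft : ∀ x ∈ Ω, ∀ v, leftInv (fderiv ℝ F x) (fderiv ℝ F x v) = v := fun x hx v =>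
    leftInv_eq (hF.eq_zero_of_lorentzL_self hx) fun _ => rfl
  have hW : ∀ x ∈ Ω, ∀ v, (-((fderiv ℝ ξ x).comp (leftInv (fderiv ℝ F x)))) (fderiv ℝ F x v) =
      -fderiv ℝ ξ x v := fun x hx v => by
    rw [neg_apply, ContinuousLinearMap.comp_apply, hleft x hx]
  refine sum_normal_products_eq_zero (ξ := ξ)
    (S := fun x => -((fderiv ℝ ξ x).comp (leftInv (fderiv ℝ F x)))) lorentzL_comm hF.isOpen
    hF.smooth hξ.smooth (hF.contDiffOn_ambientShape hξ.smooth) hW ?_ hx₀ e l β hβs hβx ?_ horth ?_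
  -- Pairings with the ambient operator depend only on tangential components, so its
  -- self-adjointness reduces to that of `shapeL`.
  · have key : ∀ x ∈ Ω, ∀ y z,
        lorentzL m ((-((fderiv ℝ ξ x).comp (leftInv (fderiv ℝ F x)))) y) z =
        lorentzL m (fderiv ℝ F x (shapeL F ξ x (leftInv (fderiv ℝ F x) y)))
          (fderiv ℝ F x (leftInv (fderiv ℝ F x) z)) := by
      intro x hx y z
      rw [neg_apply, ContinuousLinearMap.comp_apply, hF.fderiv_parallel hξ hx, neg_neg,
        lorentzL_comm _ z, ← lorentzL_leftInv (hF.eq_zero_of_lorentzL_self hx), lorentzL_comm]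
    intro x hx y z
    rw [lorentzL_comm y, key x hx, key x hx, hF.shapeL_symm hξ.smooth hξ.orth_fderiv hx,
      lorentzL_comm]
  · intro i y hy
    rw [hW y hy, hF.fderiv_parallel hξ hy, neg_neg, hβ i y hy, map_smul]
  · intro η hη
    have hη' : ∀ v, lorentzL m η (fderiv ℝ F x₀ v) = 0 := by
      intro v
      rw [← e.sum_repr v]
      simp only [map_sum, map_smul, smul_eq_mul]
      exact Finset.sum_eq_zero fun i _ => by rw [hη i, mul_zero]
    have : leftInv (fderiv ℝ F x₀) η = 0 :=
      leftInv_eq (hF.eq_zero_of_lorentzL_self hx₀) fun w => by simp [hη']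
    simp [this]

/-- A minimal immersion with constant principal curvatures along the parallel field `ξ` has
vanishing second fundamental form in the direction of `ξ`. -/
theorem shape_eq_zero (hF : IsHypImmersionOn F Ω) (hξ : IsParallelOn F ξ Ω)
    {x₀ : 𝔼} (hx₀ : x₀ ∈ Ω)
    (hconst : ∀ x ∈ Ω, (shapeL F ξ x : 𝔼 →ₗ[ℝ] 𝔼).charpoly.roots =
      (shapeL F ξ x₀ : 𝔼 →ₗ[ℝ] 𝔼).charpoly.roots)
    (hmin : ∀ e : Module.Basis (Fin n) ℝ (EuclideanSpace ℝ (Fin n)),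
      (∀ i j, lorentzL m (fderiv ℝ F x₀ (e i)) (fderiv ℝ F x₀ (e j)) = if i = j then 1 else 0) →
      ∀ ζ, lorentzL m ζ (F x₀) = 0 → (∀ v, lorentzL m ζ (fderiv ℝ F x₀ v) = 0) →
        ∑ i, lorentzL m (fderiv ℝ (fderiv ℝ F) x₀ (e i) (e i)) ζ = 0) (v w : 𝔼) :
    lorentzL m (fderiv ℝ (fderiv ℝ F) x₀ v w) (ξ x₀) = 0 := by
  classical
  obtain ⟨e, l, horth, heig⟩ := hF.exists_eigenbasis hξ.smooth hξ.orth_fderiv hx₀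
  have hsum := hF.sum_principal_products_eq_zero hξ hx₀ hconst e l horth heig
  set B := lorentzL m with hB
  set H := fderiv ℝ (fderiv ℝ F) x₀ with hH
  set J := fderiv ℝ F x₀ with hJ
  set p := F x₀ with hp
  set N := orthPart B (fun c => J (e c)) with hN
  have hpp : B p p = -1 := hF.lorentzL_self hx₀
  have hJp : ∀ v, B (J v) p = 0 := hF.lorentzL_fderiv hx₀
  have hHp : ∀ v w, B (H v w) p = -B (J v) (J w) := by
    intro v w
    have h := ((lorentzL m).hasFDerivAt.comp x₀
      ((hasFDerivAt_of_contDiffOn (contDiffOn_fderiv hF.smooth hF.isOpen) hF.isOpen hx₀).clm_apply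
        (hasFDerivAt_const w x₀))).clm_apply (hasFDerivAt_of_contDiffOn hF.smooth hF.isOpen hx₀)
    have h0 := DFunLike.congr_fun (hasFDerivAt_eq_zero_of_eqOn hF.isOpen hx₀ h
      (fun y hy => hF.lorentzL_fderiv hy w)) v
    simp at h0
    rw [lorentzL_comm (J v)]
    linarith
  have hNp : ∀ y, B (N y) p = B y p := fun y => by
    simp [hN, orthPart, hJp]
  have hspan : ∀ η, (∀ i, B η (J (e i)) = 0) → ∀ v, B η (J v) = 0 := by
    intro η h v
    rw [← e.sum_repr v]
    simp only [map_sum, map_smul, smul_eq_mul]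
    exact Finset.sum_eq_zero fun i _ => by rw [h i, mul_zero]
  -- By `hHp` and `⟨p, p⟩ = -1` the component of `N (H (e i) (e i))` along the position vector is
  -- `p` itself; removing it leaves the second fundamental form in `ℍ^m(-1)`.
  set II : Fin n → LorentzSpace m := fun i => N (H (e i) (e i)) - p with hII
  have hIIp : ∀ i, B (II i) p = 0 := fun i => by
    simp [hII, hNp, hHp, hpp, horth]
  have hIIJ : ∀ i v, B (II i) (J v) = 0 := fun i => hspan _ fun c => by
    simp only [hII, map_sub, sub_apply]
    rw [orthPart_orthogonal horth, lorentzL_comm p, hJp, sub_zero]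
  have hprod : ∀ i j, B (N (H (e i) (e i))) (N (H (e j) (e j))) = B (II i) (II j) - 1 := by
    intro i j
    have e1 : ∀ i, N (H (e i) (e i)) = II i + p := fun i => by simp [hII]
    rw [e1 i, e1 j]
    simp only [map_add, add_apply, hIIp, hpp]
    rw [show B p (II j) = 0 from (lorentzL_comm _ _).trans (hIIp j)]
    ring
  have hIIζ : ∀ i ζ, B ζ p = 0 → (∀ v, B ζ (J v) = 0) → B (II i) ζ = B (H (e i) (e i)) ζ := by
    intro i ζ h1 h2
    simp only [hII, hN, orthPart, map_sub, sub_apply, map_sum, sum_apply, map_smul, smul_apply]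
    rw [lorentzL_comm p, h1, Finset.sum_eq_zero fun c _ => by
      rw [show B (J (e c)) ζ = 0 from (lorentzL_comm _ _).trans (h2 _), smul_zero]]
    simp
  have hmean : ∑ i, II i = 0 := by
    have h1 : B (∑ i, II i) p = 0 := by simp [hIIp]
    have h2 : ∀ v, B (∑ i, II i) (J v) = 0 := fun v => by simp [hIIJ]
    -- The sum is itself a normal vector, so `hmin` may be applied with `ζ` equal to it.
    refine eq_zero_of_orthogonal (hF.mem x₀ hx₀) h1 ?_
    conv_lhs => enter [1]; rw [map_sum]
    rw [sum_apply, ← hmin e horth _ h1 h2]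
    exact Finset.sum_congr rfl fun i _ => hIIζ i _ h1 h2
  have htot : ∑ i, ∑ j, B (II i) (II j) = 0 := by
    simp only [← map_sum, hmean, map_zero, Finset.sum_const_zero]
  -- Grouped by eigenvalue, the sum becomes one of squares of vectors orthogonal to `p`, which are
  -- spacelike.
  have hblock : 0 ≤ ∑ i, ∑ j, if l i = l j then B (II i) (II j) else 0 := by
    have e2 : ∑ i, ∑ j, (if l i = l j then B (II i) (II j) else 0) =
        ∑ μ ∈ Finset.univ.image l, B (∑ i with l i = μ, II i) (∑ i with l i = μ, II i) := by
      rw [← Finset.sum_fiberwise_of_maps_to (s := Finset.univ) (t := Finset.univ.image l) (g := l)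
        (fun i _ => Finset.mem_image_of_mem l (Finset.mem_univ i))]
      refine Finset.sum_congr rfl fun μ _ => ?_
      simp only [map_sum, sum_apply]
      conv_rhs => rw [Finset.sum_comm]
      refine Finset.sum_congr rfl fun i hi => ?_
      rw [Finset.sum_filter]
      refine Finset.sum_congr rfl fun j _ => ?_
      rw [(Finset.mem_filter.1 hi).2]
      simp only [eq_comm]
    rw [e2]
    refine Finset.sum_nonneg fun μ _ => ?_
    refine (lorentz_self_nonneg_of_orthogonal (hF.mem x₀ hx₀) ?_).1
    change B _ p = 0
    simp [hIIp]
  -- The `-1` in `hprod`, the curvature of `ℍ^m(-1)`, makes each pair with distinct eigenvalues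
  -- contribute 1; this sign drives the whole argument.
  have hcount : ∑ i, ∑ j, (if l i = l j then (0 : ℝ) else 1) ≤ 0 := by
    have e3 : ∑ i, ∑ j, (if l i = l j then (0 : ℝ) else 1) =
        ∑ i, ∑ j, B (II i) (II j) - (∑ i, ∑ j, if l i = l j then B (II i) (II j) else 0) -
        ∑ i, ∑ j, (if l i = l j then 0 else B (N (H (e i) (e i))) (N (H (e j) (e j)))) := by
      simp only [← Finset.sum_sub_distrib]
      refine Finset.sum_congr rfl fun i _ => Finset.sum_congr rfl fun j _ => ?_
      split_ifs
      · ring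
      · rw [hprod]; ring
    rw [e3, htot, hsum]
    linarith
  have heq : ∀ i j, l i = l j := by
    intro i j
    have hnn : ∀ i j, (0 : ℝ) ≤ if l i = l j then (0 : ℝ) else 1 := fun i j => by
      split_ifs <;> norm_num
    have h1 := (Finset.sum_eq_zero_iff_of_nonneg fun i _ =>
      Finset.sum_nonneg fun j _ => hnn i j).1
      (le_antisymm hcount (Finset.sum_nonneg fun i _ => Finset.sum_nonneg fun j _ => hnn i j))
      i (Finset.mem_univ i)
    have h2 := (Finset.sum_eq_zero_iff_of_nonneg fun j _ => hnn i j).1 h1 j (Finset.mem_univ j)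
    by_contra hne
    simp [hne] at h2
  have hspec := fun v w => hF.shapeL_spec hξ.smooth hξ.orth_fderiv hx₀ v w
  have htr : ∑ i, l i = 0 := by
    rw [← hmin e horth _ (hξ.orth_self x₀ hx₀) (hξ.orth_fderiv x₀ hx₀)]
    refine Finset.sum_congr rfl fun i _ => ?_
    rw [← hspec, heig, map_smul, map_smul, smul_apply, horth]
    simp
  have hl0 : ∀ i, l i = 0 := by
    intro i
    rw [Finset.sum_congr rfl fun j _ => heq j i] at htr
    have hn : (n : ℝ) ≠ 0 := by
      have := i.pos
      positivity
    simpa [hn] using htr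
  have hA : ∀ v, shapeL F ξ x₀ v = 0 := by
    intro v
    rw [← e.sum_repr v]
    simp only [map_sum, map_smul, heig, hl0, zero_smul, smul_zero, Finset.sum_const_zero]
  rw [← hspec, hA]
  simp

/-- A flat normal connection has parallel fields with prescribed value. -/
theorem exists_parallel (hF : IsHypImmersionOn F Ω)
    (hflat : ∀ x ∈ Ω, ∀ v w y,
      normalL F x (fderiv ℝ (normalL F) x v (fderiv ℝ (normalL F) x w y)) =
        normalL F x (fderiv ℝ (normalL F) x w (fderiv ℝ (normalL F) x v y)))
    {x₀ : 𝔼} (hx₀ : x₀ ∈ Ω) {η : LorentzSpace m} (hη : lorentzL m η (F x₀) = 0)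
    (hηJ : ∀ v, lorentzL m η (fderiv ℝ F x₀ v) = 0) :
    ∃ r > 0, Metric.ball x₀ r ⊆ Ω ∧ ∃ ξ : 𝔼 → LorentzSpace m,
      IsParallelOn F ξ (Metric.ball x₀ r) ∧ ξ x₀ = η := by
  obtain ⟨r, hr, hb, ξ, hs, h0, h⟩ := exists_parallel_section hF.isOpen hF.contDiffOn_normalL
    (fun x hx => hF.normalL_normalL hx) hflat hx₀ (hF.normalL_of_normal hx₀ hη hηJ)
  refine ⟨r, hr, hb, ξ, ⟨hs, fun x hx => ?_, fun x hx v => ?_, fun x hx v => ?_⟩, h0⟩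
  · rw [← (h x hx).1]; exact hF.lorentzL_normalL_self (hb hx) _
  · rw [← (h x hx).1]; exact hF.lorentzL_normalL_fderiv (hb hx) _ v
  · rw [(h x hx).2, projection_comp_fderiv hF.isOpen hF.contDiffOn_normalL
      (fun x hx => hF.normalL_normalL hx) (hb hx), (h x hx).1, sub_self]

end IsHypImmersionOn

end ParallelField

/-! ### Differentials and second derivatives in a fixed chart. -/

section Chart

variable {n m : ℕ} {M : Type*} [TopologicalSpace M] [ChartedSpace (EuclideanSpace ℝ (Fin n)) M]

local notation "𝔼" => EuclideanSpace ℝ (Fin n)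

/-- The derivative at `q` of the preferred chart at `p`, read in the preferred chart at `q`. -/
noncomputable def chartDeriv (n : ℕ) {M : Type*} [TopologicalSpace M]
    [ChartedSpace (EuclideanSpace ℝ (Fin n)) M] (p q : M) :
    EuclideanSpace ℝ (Fin n) →L[ℝ] EuclideanSpace ℝ (Fin n) :=
  mfderiv (𝓡 n) 𝓘(ℝ, EuclideanSpace ℝ (Fin n)) (extChartAt (𝓡 n) p) q

/-- The expression of `f` in the preferred chart at `p`. -/
noncomputable def chartExpr (n : ℕ) {m : ℕ} {M : Type*} [TopologicalSpace M]
    [ChartedSpace (EuclideanSpace ℝ (Fin n)) M] (f : M → LorentzSpace m) (p : M) :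
    EuclideanSpace ℝ (Fin n) → LorentzSpace m :=
  f ∘ (extChartAt (𝓡 n) p).symm

/-- The differential of `f` as a linear map in the coordinates of the preferred chart. -/
noncomputable def diffL (n : ℕ) {m : ℕ} {M : Type*} [TopologicalSpace M]
    [ChartedSpace (EuclideanSpace ℝ (Fin n)) M] (f : M → LorentzSpace m) (p : M) :
    EuclideanSpace ℝ (Fin n) →L[ℝ] LorentzSpace m :=
  mfderiv (𝓡 n) 𝓘(ℝ, LorentzSpace m) f p

theorem diff_eq_diffL (f : M → LorentzSpace m) (p : M) (v : TangentSpace (𝓡 n) p) :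
    diff f p v = diffL n f p v := rfl

theorem diffL_congr {f g : M → LorentzSpace m} {q : M} (h : f =ᶠ[𝓝 q] g) :
    diffL n f q = diffL n g q :=
  h.mfderiv_eq

theorem chartDeriv_isInvertible [IsManifold (𝓡 n) ∞ M] {p q : M}
    (hq : q ∈ (extChartAt (𝓡 n) p).source) : (chartDeriv n p q).IsInvertible := by
  have : IsManifold (𝓡 n) 1 M := IsManifold.of_le (n := ∞) (mod_cast le_top)
  exact isInvertible_mfderiv_extChartAt hq

theorem mdifferentiableAt_chart [IsManifold (𝓡 n) ∞ M] {p q : M}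
    (hq : q ∈ (extChartAt (𝓡 n) p).source) :
    MDifferentiableAt (𝓡 n) 𝓘(ℝ, EuclideanSpace ℝ (Fin n)) (extChartAt (𝓡 n) p) q :=
  (contMDiffAt_extChartAt' (n := ∞) (by rwa [extChartAt_source] at hq)).mdifferentiableAt (by simp)

theorem diffL_comp_chart [IsManifold (𝓡 n) ∞ M] {p q : M}
    (hq : q ∈ (extChartAt (𝓡 n) p).source) {K : 𝔼 → LorentzSpace m}
    (hK : DifferentiableAt ℝ K (extChartAt (𝓡 n) p q)) :
    diffL n (fun q => K (extChartAt (𝓡 n) p q)) q =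
      (fderiv ℝ K (extChartAt (𝓡 n) p q)).comp (chartDeriv n p q) := by
  have := mfderiv_comp q (I := 𝓡 n) (I' := 𝓘(ℝ, EuclideanSpace ℝ (Fin n)))
    (I'' := 𝓘(ℝ, LorentzSpace m)) (g := K) hK.mdifferentiableAt (mdifferentiableAt_chart hq)
  rw [mfderiv_eq_fderiv] at this
  exact this

theorem eventually_mem_chart_source {p q : M} (hq : q ∈ (extChartAt (𝓡 n) p).source) :
    ∀ᶠ q' in 𝓝 q, q' ∈ (extChartAt (𝓡 n) p).source :=
  (isOpen_extChartAt_source p).eventually_mem hq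

theorem contDiffOn_chartExpr [IsManifold (𝓡 n) ∞ M] {f : M → LorentzSpace m}
    (hf : ContMDiff (𝓡 n) 𝓘(ℝ, LorentzSpace m) ∞ f) (p : M) :
    ContDiffOn ℝ ∞ (chartExpr n f p) (extChartAt (𝓡 n) p).target := by
  rw [← contMDiffOn_iff_contDiffOn]
  exact hf.comp_contMDiffOn (contMDiffOn_extChartAt_symm p)

theorem diffL_eq_fderiv [IsManifold (𝓡 n) ∞ M] {f : M → LorentzSpace m}
    (hf : ContMDiff (𝓡 n) 𝓘(ℝ, LorentzSpace m) ∞ f) {p q : M}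
    (hq : q ∈ (extChartAt (𝓡 n) p).source) :
    diffL n f q = (fderiv ℝ (chartExpr n f p) (extChartAt (𝓡 n) p q)).comp (chartDeriv n p q) := by
  rw [← diffL_comp_chart hq]
  · refine diffL_congr ?_
    filter_upwards [eventually_mem_chart_source hq] with q' hq'
    change f q' = f ((extChartAt (𝓡 n) p).symm (extChartAt (𝓡 n) p q'))
    rw [(extChartAt (𝓡 n) p).left_inv hq']
  · exact (hasFDerivAt_of_contDiffOn (contDiffOn_chartExpr hf p) (isOpen_extChartAt_target p)
      ((extChartAt (𝓡 n) p).map_source hq)).differentiableAt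

theorem IsHyperbolicImmersion.chartExpr [IsManifold (𝓡 n) ∞ M] {f : M → LorentzSpace m}
    (hf : IsHyperbolicImmersion (n := n) f) (p : M) :
    IsHypImmersionOn (chartExpr n f p) (extChartAt (𝓡 n) p).target where
  isOpen := isOpen_extChartAt_target p
  smooth := contDiffOn_chartExpr hf.smooth p
  mem x hx := hf.mem _
  injective x hx := by
    have hq := (extChartAt (𝓡 n) p).map_target hx
    have h1 := diffL_eq_fderiv hf.smooth hq
    rw [(extChartAt (𝓡 n) p).right_inv hx] at h1
    have hinj : Function.Injective (diffL n f ((extChartAt (𝓡 n) p).symm x)) :=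
      hf.injective_diff _
    rw [h1, ContinuousLinearMap.coe_comp] at hinj
    exact hinj.of_comp_right (chartDeriv_isInvertible hq).surjective

theorem chartDeriv_eq_fderiv [IsManifold (𝓡 n) ∞ M] {p q : M}
    (hq : q ∈ (extChartAt (𝓡 n) p).source) :
    chartDeriv n p q = fderiv ℝ (extChartAt (𝓡 n) p ∘ (extChartAt (𝓡 n) q).symm)
      (extChartAt (𝓡 n) q q) := by
  have := (mdifferentiableAt_chart hq).mfderiv
  rw [chartDeriv, this, writtenInExtChartAt, (𝓡 n).range_eq_univ, fderivWithin_univ]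
  rfl

/-- Change of charts for the second derivative. -/
theorem secondDeriv_eq [IsManifold (𝓡 n) ∞ M] {f : M → LorentzSpace m}
    (hf : ContMDiff (𝓡 n) 𝓘(ℝ, LorentzSpace m) ∞ f) {p q : M}
    (hq : q ∈ (extChartAt (𝓡 n) p).source) (v w : TangentSpace (𝓡 n) q) :
    ∃ u, secondDeriv f q v w =
      fderiv ℝ (fderiv ℝ (chartExpr n f p)) (extChartAt (𝓡 n) p q) (chartDeriv n p q v)
        (chartDeriv n p q w) + fderiv ℝ (chartExpr n f p) (extChartAt (𝓡 n) p q) u := by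
  set φ := extChartAt (𝓡 n) p with hφ
  set ψ := extChartAt (𝓡 n) q with hψ
  set F := chartExpr n f p with hF
  set τ := φ ∘ ψ.symm with hτ
  set Ω := ψ.target ∩ ψ.symm ⁻¹' φ.source with hΩ
  have hΩo : IsOpen Ω :=
    (continuousOn_extChartAt_symm q).isOpen_inter_preimage (isOpen_extChartAt_target q)
      (isOpen_extChartAt_source p)
  have hy : ψ q ∈ Ω := ⟨mem_extChartAt_target q, by
    change ψ.symm (ψ q) ∈ φ.source; rwa [ψ.left_inv (mem_extChartAt_source q)]⟩
  have hτs : ContDiffOn ℝ ∞ τ Ω := by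
    rw [← contMDiffOn_iff_contDiffOn]
    refine ContMDiffOn.comp (t := φ.source) ?_
      ((contMDiffOn_extChartAt_symm q).mono Set.inter_subset_left) Set.inter_subset_right
    rw [hφ, extChartAt_source]
    exact contMDiffOn_extChartAt
  have hτm : ∀ y ∈ Ω, τ y ∈ φ.target := fun y hy => φ.map_source hy.2
  have hτq : τ (ψ q) = φ q := by
    change φ (ψ.symm (ψ q)) = φ q
    rw [ψ.left_inv (mem_extChartAt_source q)]
  have hFs := contDiffOn_chartExpr hf p
  have hto := isOpen_extChartAt_target (I := 𝓡 n) p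
  have heq : ∀ y ∈ Ω, (f ∘ ψ.symm) y = (F ∘ τ) y := fun y hy => by
    change f (ψ.symm y) = f (φ.symm (φ (ψ.symm y)))
    rw [φ.left_inv hy.2]
  have hd1 : ∀ y ∈ Ω, fderiv ℝ (f ∘ ψ.symm) y = (fderiv ℝ F (τ y)).comp (fderiv ℝ τ y) := by
    intro y hy
    rw [(Filter.eventuallyEq_of_mem (hΩo.mem_nhds hy) heq).fderiv_eq]
    exact ((hasFDerivAt_of_contDiffOn hFs hto (hτm y hy)).comp y
      (hasFDerivAt_of_contDiffOn hτs hΩo hy)).fderiv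
  have hd2 := (((hasFDerivAt_of_contDiffOn (contDiffOn_fderiv hFs hto) hto (hτm _ hy)).comp (ψ q)
      (hasFDerivAt_of_contDiffOn hτs hΩo hy)).clm_comp
      (hasFDerivAt_of_contDiffOn (contDiffOn_fderiv hτs hΩo) hΩo hy))
  have hd3 := (Filter.eventuallyEq_of_mem (hΩo.mem_nhds hy) hd1).fderiv_eq.trans hd2.fderiv
  -- The second derivative of the transition map enters only through `dF`, so the correction is
  -- tangent.
  refine ⟨fderiv ℝ (fderiv ℝ τ) (ψ q) v w, ?_⟩
  have hc : chartDeriv n p q = fderiv ℝ τ (ψ q) := chartDeriv_eq_fderiv hq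
  rw [secondDeriv, ← hψ, hd3, hc, ← hτq]
  exact add_comm _ _

end Chart

/-! ### Gram matrices and traces. -/

section GramMatrix

variable {n m : ℕ} {V : Type*} [AddCommGroup V] [Module ℝ V]

/-- The Gram matrix of a basis for the form induced by `J`. -/
noncomputable def gramOf (J : V →ₗ[ℝ] LorentzSpace m) (b : Module.Basis (Fin n) ℝ V) :
    Matrix (Fin n) (Fin n) ℝ :=
  Matrix.of fun i j => lorentzL m (J (b i)) (J (b j))

variable {J : V →ₗ[ℝ] LorentzSpace m} (b : Module.Basis (Fin n) ℝ V)

/-- A kernel vector of the Gram matrix gives a combination of the basis orthogonal to every basis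
vector, hence to itself. -/
theorem isUnit_det_gramOf (hJ : ∀ v, lorentzL m (J v) (J v) = 0 → v = 0) :
    IsUnit (gramOf J b).det := by
  rw [← Matrix.isUnit_iff_isUnit_det, ← Matrix.mulVec_injective_iff_isUnit]
  refine (injective_iff_map_eq_zero (gramOf J b).mulVecLin).2 fun a ha => ?_
  have h0 : ∑ j, a j • b j = 0 := by
    refine hJ _ ?_
    have h1 : ∀ i, lorentzL m (J (b i)) (J (∑ j, a j • b j)) = 0 := by
      intro i
      have := congrFun ha i
      simp only [Matrix.mulVecLin_apply, Matrix.mulVec, dotProduct, gramOf, Matrix.of_apply,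
        Pi.zero_apply] at this
      rw [← this]
      simp [mul_comm]
    nth_rewrite 1 [map_sum]
    rw [map_sum, sum_apply]
    refine Finset.sum_eq_zero fun i _ => ?_
    rw [map_smul, map_smul, smul_apply, h1, smul_zero]
  funext i
  exact linearIndependent_iff'.1 b.linearIndependent Finset.univ a h0 i (Finset.mem_univ i)

theorem lorentzL_gram_inv_sum (hJ : ∀ v, lorentzL m (J v) (J v) = 0 → v = 0)
    (X : LorentzSpace m) (w : V) :
    lorentzL m (J (∑ k, ∑ l, ((gramOf J b)⁻¹ k l * lorentzL m X (J (b l))) • b k)) (J w) =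
      lorentzL m X (J w) := by
  have key : ∀ j,
      lorentzL m (J (∑ k, ∑ l, ((gramOf J b)⁻¹ k l * lorentzL m X (J (b l))) • b k)) (J (b j)) =
      lorentzL m X (J (b j)) := by
    intro j
    have hG := Matrix.mul_nonsing_inv _ (isUnit_det_gramOf b hJ)
    have h1 : ∀ l, ∑ k, (gramOf J b)⁻¹ k l * lorentzL m (J (b k)) (J (b j)) =
        if j = l then 1 else 0 := by
      intro l
      have := congrFun (congrFun hG j) l
      rw [Matrix.mul_apply, Matrix.one_apply] at this
      rw [← this]
      refine Finset.sum_congr rfl fun k _ => ?_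
      rw [mul_comm, lorentzL_comm]; rfl
    simp only [map_sum, map_smul, sum_apply, smul_apply, smul_eq_mul]
    rw [Finset.sum_comm]
    calc _ = ∑ l, lorentzL m X (J (b l)) *
          ∑ k, (gramOf J b)⁻¹ k l * lorentzL m (J (b k)) (J (b j)) := by
          refine Finset.sum_congr rfl fun l _ => ?_
          rw [Finset.mul_sum]
          exact Finset.sum_congr rfl fun k _ => by ring
      _ = _ := by simp [h1]
  rw [← b.sum_repr w]
  generalize hT : (∑ k, ∑ l, ((gramOf J b)⁻¹ k l * lorentzL m X (J (b l))) • b k) = T at key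
  simp only [map_sum, map_smul, key]

/-- The trace of a bilinear form can be computed in any basis. -/
theorem sum_gram_inv_mul (e : Module.Basis (Fin n) ℝ V)
    (he : ∀ i j, lorentzL m (J (e i)) (J (e j)) = if i = j then 1 else 0)
    (h : V →ₗ[ℝ] V →ₗ[ℝ] ℝ) :
    ∑ i, ∑ j, (gramOf J b)⁻¹ i j * h (b i) (b j) = ∑ i, h (e i) (e i) := by
  -- With `P` the change of basis, the Gram matrix is `Pᵀ P` and the form has matrix `Pᵀ Q P`, so
  -- their quotient is conjugate to `Q` and has the same trace.
  set P : Matrix (Fin n) (Fin n) ℝ := e.toMatrix b with hP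
  have hb : ∀ i, b i = ∑ a, P a i • e a := fun i => by
    rw [hP]; exact (e.sum_repr (b i)).symm
  set Q : Matrix (Fin n) (Fin n) ℝ := Matrix.of fun i j => h (e i) (e j) with hQ
  have hG : gramOf J b = P.transpose * P := by
    ext i j
    simp only [gramOf, Matrix.of_apply, hb, map_sum, map_smul, sum_apply, smul_apply, he,
      Matrix.mul_apply, Matrix.transpose_apply, smul_eq_mul]
    simp [mul_comm]
  have hH : (Matrix.of fun i j => h (b i) (b j)) = P.transpose * Q * P := by
    ext i j
    simp only [Matrix.of_apply, hb, map_sum, map_smul, LinearMap.sum_apply, LinearMap.smul_apply,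
      Matrix.mul_apply, Matrix.transpose_apply, smul_eq_mul, hQ, Finset.sum_mul, Finset.mul_sum]
    refine Finset.sum_congr rfl fun c _ => Finset.sum_congr rfl fun a _ => ?_
    ring
  have hPu : P * b.toMatrix e = 1 := e.toMatrix_mul_toMatrix_flip b
  have hPdet : IsUnit P.det := by
    refine IsUnit.of_mul_eq_one (b.toMatrix e).det ?_
    rw [← Matrix.det_mul, hPu, Matrix.det_one]
  have hPt : IsUnit P.transpose.det := by rwa [Matrix.det_transpose]
  have hsym : ∀ i j, gramOf J b i j = gramOf J b j i := fun i j => lorentzL_comm _ _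
  have hinvt : ((gramOf J b)⁻¹).transpose = (gramOf J b)⁻¹ := by
    rw [Matrix.transpose_nonsing_inv]
    congr 1
    ext i j; exact hsym j i
  calc ∑ i, ∑ j, (gramOf J b)⁻¹ i j * h (b i) (b j)
      = ((gramOf J b)⁻¹ * Matrix.of fun i j => h (b i) (b j)).trace := by
        rw [Matrix.trace, Finset.sum_comm]
        simp only [Matrix.diag, Matrix.mul_apply, Matrix.of_apply]
        refine Finset.sum_congr rfl fun j _ => Finset.sum_congr rfl fun i _ => ?_
        rw [← Matrix.transpose_apply (gramOf J b)⁻¹, hinvt]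
    _ = (P⁻¹ * (P.transpose⁻¹ * P.transpose) * Q * P).trace := by
        rw [hG, hH, Matrix.mul_inv_rev]
        simp only [Matrix.mul_assoc]
    _ = Q.trace := by
        rw [Matrix.nonsing_inv_mul _ hPt, Matrix.mul_one, Matrix.trace_mul_comm,
          ← Matrix.mul_assoc, Matrix.mul_nonsing_inv _ hPdet, Matrix.one_mul]
    _ = _ := rfl

/-- The matrix of an endomorphism `A` with `g(A v, w) = h(v, w)`. -/
theorem gram_inv_mul_eq_toMatrix (hJ : ∀ v, lorentzL m (J v) (J v) = 0 → v = 0) (A : V →ₗ[ℝ] V)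
    (h : V → V → ℝ) (hA : ∀ v w, lorentzL m (J (A v)) (J w) = h w v) :
    (gramOf J b)⁻¹ * (Matrix.of fun i j => h (b i) (b j)) = LinearMap.toMatrix b b A := by
  have h1 : (Matrix.of fun i j => h (b i) (b j)) = gramOf J b * LinearMap.toMatrix b b A := by
    ext i j
    rw [Matrix.of_apply, ← hA, Matrix.mul_apply]
    conv_lhs => rw [← b.sum_repr (A (b j))]
    simp only [map_sum, map_smul, sum_apply, smul_apply, smul_eq_mul, LinearMap.toMatrix_apply,
      gramOf, Matrix.of_apply]
    exact Finset.sum_congr rfl fun k _ => by rw [mul_comm, lorentzL_comm]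
  rw [h1, ← Matrix.mul_assoc, Matrix.nonsing_inv_mul _ (isUnit_det_gramOf b hJ), Matrix.one_mul]

end GramMatrix

/-! ### Geometric objects of the manifold expressed in a chart. -/

section Transfer

variable {n m : ℕ} {M : Type*} [TopologicalSpace M] [ChartedSpace (EuclideanSpace ℝ (Fin n)) M]
  {f : M → LorentzSpace m} {p q : M}

local notation "𝔼" => EuclideanSpace ℝ (Fin n)

theorem chartExpr_apply (hq : q ∈ (extChartAt (𝓡 n) p).source) :
    chartExpr n f p (extChartAt (𝓡 n) p q) = f q := by
  change f ((extChartAt (𝓡 n) p).symm (extChartAt (𝓡 n) p q)) = f q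
  rw [(extChartAt (𝓡 n) p).left_inv hq]

variable [IsManifold (𝓡 n) ∞ M]

/-- The coordinate basis at `q`, read in the chart at `p`. -/
noncomputable def coordBasis (hq : q ∈ (extChartAt (𝓡 n) p).source) :
    Module.Basis (Fin n) ℝ (EuclideanSpace ℝ (Fin n)) :=
  (EuclideanSpace.basisFun (Fin n) ℝ).toBasis.map
    (Classical.choose (chartDeriv_isInvertible hq)).toLinearEquiv

theorem coordBasis_apply (hq : q ∈ (extChartAt (𝓡 n) p).source) (i : Fin n) :
    coordBasis hq i = chartDeriv n p q (coordVec q i) := by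
  have h := Classical.choose_spec (chartDeriv_isInvertible hq)
  change coordBasis hq i = chartDeriv n p q (EuclideanSpace.single i 1)
  rw [coordBasis, Module.Basis.map_apply]
  conv_rhs => rw [← h]
  simp

namespace IsHyperbolicImmersion

theorem diff_eq (hf : IsHyperbolicImmersion (n := n) f)
    (hq : q ∈ (extChartAt (𝓡 n) p).source) (v : TangentSpace (𝓡 n) q) :
    diff f q v = fderiv ℝ (HypSubmanifold.chartExpr n f p) (extChartAt (𝓡 n) p q)
      (chartDeriv n p q v) := by
  rw [diff_eq_diffL, diffL_eq_fderiv hf.smooth hq]; rfl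

theorem diff_coordVec (hf : IsHyperbolicImmersion (n := n) f)
    (hq : q ∈ (extChartAt (𝓡 n) p).source) (i : Fin n) :
    diff f q (coordVec q i) =
      fderiv ℝ (HypSubmanifold.chartExpr n f p) (extChartAt (𝓡 n) p q) (coordBasis hq i) := by
  rw [hf.diff_eq hq, coordBasis_apply]

theorem gram_eq (hf : IsHyperbolicImmersion (n := n) f)
    (hq : q ∈ (extChartAt (𝓡 n) p).source) :
    gram f q = gramOf
      (fderiv ℝ (HypSubmanifold.chartExpr n f p) (extChartAt (𝓡 n) p q) :
        𝔼 →ₗ[ℝ] LorentzSpace m) (coordBasis hq) := by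
  ext i j
  simp only [gram, gramOf, Matrix.of_apply, hf.diff_coordVec hq]
  rfl

/-- The normal projection, in the chart at `p`. -/
theorem normalProj_eq (hf : IsHyperbolicImmersion (n := n) f)
    (hq : q ∈ (extChartAt (𝓡 n) p).source) (y : LorentzSpace m) :
    normalProj n f q y =
      normalL (HypSubmanifold.chartExpr n f p) (extChartAt (𝓡 n) p q) y := by
  have hF := hf.chartExpr p
  have hx := (extChartAt (𝓡 n) p).map_source hq
  set F := HypSubmanifold.chartExpr n f p with hFdef
  set x := extChartAt (𝓡 n) p q with hxdef
  have hFx : F x = f q := chartExpr_apply hq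
  set J : 𝔼 →ₗ[ℝ] LorentzSpace m := (fderiv ℝ F x : 𝔼 →ₗ[ℝ] LorentzSpace m) with hJ
  have hJ0 : ∀ v, lorentzL m (J v) (J v) = 0 → v = 0 := hF.eq_zero_of_lorentzL_self hx
  set X := hypProj (f q) y with hX
  have hXe : X = y + lorentzL m y (F x) • F x := by rw [hX, hypProj, hFx]; rfl
  set b := coordBasis hq with hb
  set T := ∑ k, ∑ l, ((gramOf J b)⁻¹ k l * lorentzL m X (J (b l))) • b k with hT
  have htan : tangentProj (n := n) f q X = J T := by
    simp only [tangentProj, hf.gram_eq hq, hf.diff_coordVec hq, hT, map_sum, map_smul]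
    rfl
  have hpair : ∀ w, lorentzL m (J T) (J w) = lorentzL m X (J w) :=
    lorentzL_gram_inv_sum b hJ0 X
  have hz : normalProj n f q y = X - J T := by rw [normalProj, htan]
  rw [hz]
  symm
  refine hF.normalL_eq hx (c := -lorentzL m y (F x)) (v := T) ?_ (fun w => ?_) ?_
  · have h1 : lorentzL m (J T) (F x) = 0 := hF.lorentzL_fderiv hx T
    rw [map_sub, sub_apply, h1, hXe, map_add, add_apply, map_smul, smul_apply,
      hF.lorentzL_self hx]
    simp
  · rw [map_sub, sub_apply]
    exact sub_eq_zero.2 (hpair w).symm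
  · rw [hXe, neg_smul]
    change _ = _ + J T
    abel

/-- The second fundamental form in a normal direction, in the chart at `p`. -/
theorem lorentzL_secondFF (hf : IsHyperbolicImmersion (n := n) f)
    (hq : q ∈ (extChartAt (𝓡 n) p).source) {ζ : LorentzSpace m}
    (hζF : lorentzL m ζ (HypSubmanifold.chartExpr n f p (extChartAt (𝓡 n) p q)) = 0)
    (hζJ : ∀ w, lorentzL m ζ
      (fderiv ℝ (HypSubmanifold.chartExpr n f p) (extChartAt (𝓡 n) p q) w) = 0)
    (v w : TangentSpace (𝓡 n) q) :
    lorentzL m (secondFF f q v w) ζ =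
      lorentzL m (fderiv ℝ (fderiv ℝ (HypSubmanifold.chartExpr n f p)) (extChartAt (𝓡 n) p q)
        (chartDeriv n p q v) (chartDeriv n p q w)) ζ := by
  obtain ⟨u, hu⟩ := secondDeriv_eq hf.smooth hq v w
  rw [secondFF, hf.normalProj_eq hq, IsHypImmersionOn.normalL_apply, hu, lorentzL_comm _ ζ,
    lorentzL_comm _ ζ]
  simp only [map_sub, map_add, map_smul, hζF, hζJ]
  simp

/-- The Gram-inverse formula is the matrix of `shapeL` in the transported basis `coordBasis`, and
the characteristic polynomial does not depend on the basis. -/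
theorem shapeOperator_charpoly (hf : IsHyperbolicImmersion (n := n) f)
    (hq : q ∈ (extChartAt (𝓡 n) p).source) {Ω : Set (EuclideanSpace ℝ (Fin n))}
    {ξ : EuclideanSpace ℝ (Fin n) → LorentzSpace m}
    (hF : IsHypImmersionOn (HypSubmanifold.chartExpr n f p) Ω)
    (hξ : IsParallelOn (HypSubmanifold.chartExpr n f p) ξ Ω) (hx : extChartAt (𝓡 n) p q ∈ Ω) :
    (shapeOperator n f q (ξ (extChartAt (𝓡 n) p q))).charpoly =
      (shapeL (HypSubmanifold.chartExpr n f p) ξ (extChartAt (𝓡 n) p q) :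
        EuclideanSpace ℝ (Fin n) →ₗ[ℝ] EuclideanSpace ℝ (Fin n)).charpoly := by
  have h := gram_inv_mul_eq_toMatrix
    (J := (fderiv ℝ (HypSubmanifold.chartExpr n f p) (extChartAt (𝓡 n) p q) :
        𝔼 →ₗ[ℝ] LorentzSpace m)) (coordBasis hq) (hF.eq_zero_of_lorentzL_self hx)
    (shapeL (HypSubmanifold.chartExpr n f p) ξ (extChartAt (𝓡 n) p q) : 𝔼 →ₗ[ℝ] 𝔼)
    (fun v w => lorentzL m (fderiv ℝ (fderiv ℝ (HypSubmanifold.chartExpr n f p))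
      (extChartAt (𝓡 n) p q) v w) (ξ (extChartAt (𝓡 n) p q)))
    (fun v w => (hF.shapeL_spec hξ.smooth hξ.orth_fderiv hx v w).trans
      (by rw [fderiv_fderiv_comm hF.smooth hF.isOpen hx]))
  rw [← LinearMap.charpoly_toMatrix _ (coordBasis hq), ← h, shapeOperator, hf.gram_eq hq]
  congr 2
  ext i j
  simp only [Matrix.of_apply, coordBasis_apply]
  exact hf.lorentzL_secondFF hq (hξ.orth_self _ hx) (hξ.orth_fderiv _ hx) _ _

theorem normalDeriv_comp_chart (hf : IsHyperbolicImmersion (n := n) f)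
    (hq : q ∈ (extChartAt (𝓡 n) p).source) {k : M → LorentzSpace m}
    {K : EuclideanSpace ℝ (Fin n) → LorentzSpace m}
    (hk : ∀ᶠ q' in 𝓝 q, k q' = K (extChartAt (𝓡 n) p q'))
    (hK : DifferentiableAt ℝ K (extChartAt (𝓡 n) p q)) (v : TangentSpace (𝓡 n) q) :
    normalDeriv f k q v = normalL (HypSubmanifold.chartExpr n f p) (extChartAt (𝓡 n) p q)
      (fderiv ℝ K (extChartAt (𝓡 n) p q) (chartDeriv n p q v)) := by
  rw [normalDeriv, hf.normalProj_eq hq, diff_eq_diffL,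
    diffL_congr (g := fun q => K (extChartAt (𝓡 n) p q)) hk, diffL_comp_chart hq hK]
  rfl

/-- Flatness of the normal bundle, in the chart at `p`. -/
theorem flat_chart (hf : IsHyperbolicImmersion (n := n) f) (hflat : HasFlatNormalBundle n f)
    (p : M) {x : EuclideanSpace ℝ (Fin n)} (hx : x ∈ (extChartAt (𝓡 n) p).target)
    (v w : EuclideanSpace ℝ (Fin n)) (y : LorentzSpace m) :
    normalL (HypSubmanifold.chartExpr n f p) x
        (fderiv ℝ (normalL (HypSubmanifold.chartExpr n f p)) x v
          (fderiv ℝ (normalL (HypSubmanifold.chartExpr n f p)) x w y)) =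
      normalL (HypSubmanifold.chartExpr n f p) x
        (fderiv ℝ (normalL (HypSubmanifold.chartExpr n f p)) x w
          (fderiv ℝ (normalL (HypSubmanifold.chartExpr n f p)) x v y)) := by
  have hF := hf.chartExpr p
  set φ := extChartAt (𝓡 n) p with hφ
  set F := HypSubmanifold.chartExpr n f p with hFdef
  set N := normalL F with hN
  have hNs : ContDiffOn ℝ ∞ N φ.target := hF.contDiffOn_normalL
  have hto := hF.isOpen
  set q := φ.symm x with hq'
  have hq : q ∈ φ.source := φ.map_target hx
  have hφq : φ q = x := φ.right_inv hx
  let C : 𝔼 → Π z : 𝔼, TangentSpace 𝓘(ℝ, 𝔼) z := fun v _ => v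
  -- Coordinate fields, pulled back from constant fields, have zero bracket, so the last term of the
  -- curvature disappears.
  let X : 𝔼 → Π q : M, TangentSpace (𝓡 n) q := fun v =>
    VectorField.mpullback (𝓡 n) 𝓘(ℝ, 𝔼) φ (C v)
  have hXv : ∀ v, ∀ q ∈ φ.source, chartDeriv n p q (X v q) = v := fun v q hq =>
    (chartDeriv_isInvertible hq).self_apply_inverse v
  have hman1 : IsManifold (𝓡 n) 1 M := IsManifold.of_le (n := ∞) (mod_cast le_top)
  have hman2 : IsManifold (𝓡 n) (minSmoothness ℝ 2) M := by
    rw [minSmoothness_of_isRCLikeNormedField]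
    exact IsManifold.of_le (n := ∞) (WithTop.coe_le_coe.2 (le_top : (2 : ℕ∞) ≤ ⊤))
  have hCs : ∀ v z, ContMDiffAt 𝓘(ℝ, 𝔼) 𝓘(ℝ, 𝔼).tangent ∞
      (fun z => (⟨z, C v z⟩ : TangentBundle 𝓘(ℝ, 𝔼) 𝔼)) z := fun v z =>
    contMDiffAt_vectorSpace_iff_contDiffAt.2 contDiffAt_const
  have hφs : ∀ q ∈ φ.source, ContMDiffAt (𝓡 n) 𝓘(ℝ, 𝔼) ∞ φ q := fun q hq =>
    contMDiffAt_extChartAt' (by rwa [hφ, extChartAt_source] at hq)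
  have hXs : ∀ v, IsSmoothVectorField (X v) φ.source := fun v q hq =>
    (ContMDiffAt.mpullback_vectorField_preimage (hCs v _) (hφs q hq) (chartDeriv_isInvertible hq)
      (by simp)).contMDiffWithinAt
  have hbr : VectorField.mlieBracket (𝓡 n) (X v) (X w) q = 0 := by
    have h1 := VectorField.mpullback_mlieBracket (I := 𝓡 n) (I' := 𝓘(ℝ, 𝔼)) (n := ∞) (x₀ := q)
      ((hCs v (φ q)).mdifferentiableAt (by simp)) ((hCs w (φ q)).mdifferentiableAt (by simp))
      (hφs q hq) (by
        rw [minSmoothness_of_isRCLikeNormedField]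
        exact WithTop.coe_le_coe.2 (le_top : (2 : ℕ∞) ≤ ⊤))
    rw [← h1, VectorField.mpullback_apply, ← VectorField.mlieBracketWithin_univ,
      VectorField.mlieBracketWithin_eq_lieBracketWithin]
    have h2 : VectorField.lieBracketWithin ℝ (C v) (C w) Set.univ (φ q) = 0 := by
      simp [VectorField.lieBracketWithin, C]
    rw [h2]
    exact map_zero _
  -- The normal part of a constant vector is a test field whose curvature involves only `N` and its
  -- derivatives.
  set ξ : M → LorentzSpace m := fun q => N (φ q) y with hξ
  have hξn : IsNormalField n f φ.source ξ := by
    refine ⟨?_, fun q hq => ⟨?_, fun u => ?_⟩⟩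
    · have h1 : ContMDiffOn 𝓘(ℝ, 𝔼) 𝓘(ℝ, LorentzSpace m) ∞ (fun x => N x y) φ.target :=
        contMDiffOn_iff_contDiffOn.2 (hNs.clm_apply contDiffOn_const)
      exact h1.comp (fun q hq => (hφs q hq).contMDiffWithinAt) fun q hq => φ.map_source hq
    · have := hF.lorentzL_normalL_self (φ.map_source hq) y
      rw [show F (φ q) = f q from chartExpr_apply hq] at this
      exact this
    · rw [hf.diff_eq hq]
      exact hF.lorentzL_normalL_fderiv (φ.map_source hq) y _
  have hd : ∀ x ∈ φ.target, HasFDerivAt (fun x => N x y) ((fderiv ℝ N x).flip y) x := by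
    intro x hx
    refine ((hasFDerivAt_of_contDiffOn hNs hto hx).clm_apply (hasFDerivAt_const y x)).congr_fderiv
      ?_
    ext u; simp
  have hder1 : ∀ v, ∀ q ∈ φ.source, normalDeriv f ξ q (X v q) =
      N (φ q) (fderiv ℝ N (φ q) v y) := by
    intro v q hq
    rw [hf.normalDeriv_comp_chart hq (K := fun x => N x y) (Filter.Eventually.of_forall fun _ => rfl)
      (hd _ (φ.map_source hq)).differentiableAt, hXv v q hq,
      (hd _ (φ.map_source hq)).fderiv]
    rfl
  have hder2 : ∀ v w, normalDeriv f (fun q => normalDeriv f ξ q (X w q)) q (X v q) =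
      N x (fderiv ℝ N x v (fderiv ℝ N x w y)) + N x (fderiv ℝ (fderiv ℝ N) x v w y) := by
    intro v w
    have hK := (hasFDerivAt_of_contDiffOn hNs hto hx).clm_apply
      (((hasFDerivAt_of_contDiffOn (contDiffOn_fderiv hNs hto) hto hx).clm_apply
        (hasFDerivAt_const w x)).clm_apply (hasFDerivAt_const y x))
    rw [← hφq] at hK
    rw [hf.normalDeriv_comp_chart hq (K := fun x => N x (fderiv ℝ N x w y))
      (Filter.eventually_of_mem ((isOpen_extChartAt_source p).mem_nhds hq) (hder1 w))
      hK.differentiableAt, hXv v q hq, hK.fderiv, hφq]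
    have hNN : ∀ z, normalL (HypSubmanifold.chartExpr n f p) x (N x z) = N x z := hF.normalL_normalL hx
    simp [hNN]
    exact add_comm _ _
  have h0 := hflat φ.source (isOpen_extChartAt_source p) (X v) (X w) (hXs v) (hXs w) ξ hξn q hq
  -- The terms with the second derivative of `N` are symmetric in `v` and `w` and cancel, leaving
  -- the commutator.
  rw [normalCurvature, hder2, hder2, hbr, fderiv_fderiv_comm hNs hto hx w v] at h0
  have hz : normalDeriv f ξ q (0 : TangentSpace (𝓡 n) q) = 0 := by
    rw [normalDeriv, hf.normalProj_eq hq, diff_eq_diffL]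
    have : diffL n ξ q (0 : TangentSpace (𝓡 n) q) = 0 := map_zero (diffL n ξ q)
    rw [this, map_zero]
  rw [hz, sub_zero, add_sub_add_right_eq_sub, sub_eq_zero] at h0
  exact h0

end IsHyperbolicImmersion

end Transfer

/-! ### Minimality and constant principal curvatures in a chart. -/

section Conclusion

variable {n m : ℕ} {M : Type*} [TopologicalSpace M] [ChartedSpace (EuclideanSpace ℝ (Fin n)) M]
  [IsManifold (𝓡 n) ∞ M] {f : M → LorentzSpace m}

local notation "𝔼" => EuclideanSpace ℝ (Fin n)

namespace IsHyperbolicImmersion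

/-- Minimality, in an orthonormal basis of the tangent space. -/
theorem sum_secondDeriv_eq_zero (hf : IsHyperbolicImmersion (n := n) f) {p : M}
    (hmin : meanCurvature n f p = 0) (e : Module.Basis (Fin n) ℝ (EuclideanSpace ℝ (Fin n)))
    (he : ∀ i j, lorentzL m
      (fderiv ℝ (HypSubmanifold.chartExpr n f p) (extChartAt (𝓡 n) p p) (e i))
      (fderiv ℝ (HypSubmanifold.chartExpr n f p) (extChartAt (𝓡 n) p p) (e j)) =
        if i = j then 1 else 0) {ζ : LorentzSpace m}
    (hζF : lorentzL m ζ (HypSubmanifold.chartExpr n f p (extChartAt (𝓡 n) p p)) = 0)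
    (hζJ : ∀ w, lorentzL m ζ
      (fderiv ℝ (HypSubmanifold.chartExpr n f p) (extChartAt (𝓡 n) p p) w) = 0) :
    ∑ i, lorentzL m (fderiv ℝ (fderiv ℝ (HypSubmanifold.chartExpr n f p))
      (extChartAt (𝓡 n) p p) (e i) (e i)) ζ = 0 := by
  have hp := mem_extChartAt_source (I := 𝓡 n) p
  set H := fderiv ℝ (fderiv ℝ (HypSubmanifold.chartExpr n f p)) (extChartAt (𝓡 n) p p) with hH
  let h : 𝔼 →ₗ[ℝ] 𝔼 →ₗ[ℝ] ℝ := LinearMap.mk₂ ℝ (fun v w => lorentzL m (H v w) ζ)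
    (by simp) (by simp) (by simp) (by simp)
  have key := sum_gram_inv_mul (J := (fderiv ℝ (HypSubmanifold.chartExpr n f p)
    (extChartAt (𝓡 n) p p) : 𝔼 →ₗ[ℝ] LorentzSpace m)) (coordBasis hp) e he h
  refine Eq.trans key.symm ?_
  have h0 : lorentzL m (meanCurvature n f p) ζ = 0 := by rw [hmin]; simp
  rw [← h0, meanCurvature, hf.gram_eq hp]
  simp only [map_sum, sum_apply, map_smul, smul_apply, smul_eq_mul]
  refine Finset.sum_congr rfl fun i _ => Finset.sum_congr rfl fun j _ => ?_
  rw [hf.lorentzL_secondFF hp hζF hζJ, ← coordBasis_apply, ← coordBasis_apply]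
  rfl

/-- Parallel fields in the chart at `p` have constant principal curvatures. -/
theorem charpoly_roots_shapeL_eq (hf : IsHyperbolicImmersion (n := n) f)
    (hiso : IsIsoparametric n f) (p : M) {Ω : Set (EuclideanSpace ℝ (Fin n))}
    {ξ : EuclideanSpace ℝ (Fin n) → LorentzSpace m} (hΩ : Ω ⊆ (extChartAt (𝓡 n) p).target)
    (hF : IsHypImmersionOn (HypSubmanifold.chartExpr n f p) Ω) (hconn : IsPreconnected Ω)
    (hξ : IsParallelOn (HypSubmanifold.chartExpr n f p) ξ Ω)
    {x y : EuclideanSpace ℝ (Fin n)} (hx : x ∈ Ω) (hy : y ∈ Ω) :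
    (shapeL (HypSubmanifold.chartExpr n f p) ξ x : 𝔼 →ₗ[ℝ] 𝔼).charpoly.roots =
      (shapeL (HypSubmanifold.chartExpr n f p) ξ y : 𝔼 →ₗ[ℝ] 𝔼).charpoly.roots := by
  set φ := extChartAt (𝓡 n) p with hφ
  set U := φ.source ∩ φ ⁻¹' Ω with hU
  have hUo : IsOpen U := (continuousOn_extChartAt p).isOpen_inter_preimage
    (isOpen_extChartAt_source p) hF.isOpen
  have hUc : IsPreconnected U := by
    rw [hU, ← φ.symm_image_eq_source_inter_preimage hΩ]
    exact hconn.image _ ((continuousOn_extChartAt_symm p).mono hΩ)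
  have hφs : ∀ q ∈ φ.source, ContMDiffAt (𝓡 n) 𝓘(ℝ, 𝔼) ∞ φ q := fun q hq =>
    contMDiffAt_extChartAt' (by rwa [hφ, extChartAt_source] at hq)
  have hpar : IsParallelNormalField n f U (fun q => ξ (φ q)) := by
    refine ⟨⟨?_, fun q hq => ⟨?_, fun v => ?_⟩⟩, fun q hq v => ?_⟩
    · exact (contMDiffOn_iff_contDiffOn.2 hξ.smooth).comp
        (fun q hq => (hφs q hq.1).contMDiffWithinAt) fun q hq => hq.2
    · rw [← chartExpr_apply (f := f) hq.1]
      exact hξ.orth_self _ hq.2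
    · rw [hf.diff_eq hq.1]
      exact hξ.orth_fderiv _ hq.2 _
    · rw [hf.normalDeriv_comp_chart hq.1 (K := ξ) (Filter.Eventually.of_forall fun _ => rfl)
        (hasFDerivAt_of_contDiffOn hξ.smooth hF.isOpen hq.2).differentiableAt]
      exact hξ.parallel _ hq.2 _
  have hroots : ∀ x ∈ Ω, principalCurvatures n f (φ.symm x) (ξ (φ (φ.symm x))) =
      (shapeL (HypSubmanifold.chartExpr n f p) ξ x : 𝔼 →ₗ[ℝ] 𝔼).charpoly.roots := by
    intro x hx
    have hr : φ (φ.symm x) = x := φ.right_inv (hΩ hx)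
    have hs : φ.symm x ∈ φ.source := φ.map_target (hΩ hx)
    rw [principalCurvatures, hf.shapeOperator_charpoly hs hF hξ (by rw [← hφ, hr]; exact hx),
      ← hφ, hr]
  have hmem : ∀ x ∈ Ω, φ.symm x ∈ U := fun x hx =>
    ⟨φ.map_target (hΩ hx), by rw [Set.mem_preimage, φ.right_inv (hΩ hx)]; exact hx⟩
  rw [← hroots x hx, ← hroots y hy]
  exact hiso.constant U hUo hUc _ hpar _ (hmem x hx) _ (hmem y hy)

end IsHyperbolicImmersion

end Conclusion

end HypSubmanifold

theorem lemma4p2p1 {n m : ℕ} {M : Type*} [TopologicalSpace M]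
    [ChartedSpace (EuclideanSpace ℝ (Fin n)) M] [IsManifold (𝓡 n) ∞ M]
    (f : M → HypSubmanifold.LorentzSpace m)
    (hf : HypSubmanifold.IsHyperbolicImmersion (n := n) f)
    (hiso : HypSubmanifold.IsIsoparametric n f)
    (hmin : HypSubmanifold.IsMinimal n f) :
    HypSubmanifold.IsTotallyGeodesic n f := by
  intro p v w
  have hp := mem_extChartAt_source (I := 𝓡 n) p
  have hF := hf.chartExpr p
  have hx := (extChartAt (𝓡 n) p).map_source hp
  have hZ : HypSubmanifold.secondFF f p v w =
      HypSubmanifold.normalL (HypSubmanifold.chartExpr n f p) (extChartAt (𝓡 n) p p)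
        (HypSubmanifold.secondDeriv f p v w) := hf.normalProj_eq hp _
  have hZF := hF.lorentzL_normalL_self hx (HypSubmanifold.secondDeriv f p v w)
  have hZJ := hF.lorentzL_normalL_fderiv hx (HypSubmanifold.secondDeriv f p v w)
  rw [← hZ] at hZF
  simp only [← hZ] at hZJ
  -- The normal vector `secondFF f p v w` itself is extended to a parallel field, so that the
  -- vanishing of the shape operator in its direction makes it orthogonal to itself.
  obtain ⟨r, hr, hb, ξ, hξ, hξ0⟩ :=
    hF.exists_parallel (fun x hx => hf.flat_chart hiso.flat p hx) hx hZF hZJ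
  have hF' := hF.mono Metric.isOpen_ball hb
  have hx' := Metric.mem_ball_self (x := extChartAt (𝓡 n) p p) hr
  have h0 := hF'.shape_eq_zero hξ hx'
    (fun x hx => hf.charpoly_roots_shapeL_eq hiso p hb hF' (convex_ball _ _).isPreconnected hξ
      hx hx')
    (fun e he ζ h1 h2 => hf.sum_secondDeriv_eq_zero (hmin p) e he h1 h2)
    (HypSubmanifold.chartDeriv n p p v) (HypSubmanifold.chartDeriv n p p w)
  rw [hξ0, ← hf.lorentzL_secondFF hp hZF hZJ] at h0
  exact HypSubmanifold.eq_zero_of_orthogonal (hF.mem _ hx) hZF h0
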